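/- For $d\in\mathbb N$ let $\mathbb B_d\subset\mathbb C^d$ be the open Euclidean unit ball, $\mathbb D=\mathbb B_1$, $\mathbb T=\partial\mathbb D$. Let $H^2_d$ be the Drury--Arveson space of functions $h(z)=\sum_{\alpha\in\mathbb N_0^d}c_\alpha z^\alpha$ on $\mathbb B_d$ with $\sum_\alpha|c_\alpha|^2\,\alpha!/|\alpha|!<\infty$, and let $\mathcal M_d=\{\varphi:\mathbb B_d\to\mathbb C:\ \varphi h\in H^2_d\text{ for all }h\in H^2_d\}$ be its multiplier algebra. A variety in $\mathbb B_d$ is a set $V=\{z\in\mathbb B_d:\varphi(z)=0\text{ for all }\varphi\in E\}$ with $E\subset\mathcal M_d$; put $\mathcal M_V=\{\varphi|_V:\varphi\in\mathcal M_d\}$. An analytic disc attached to the unit sphere is a variety $V\subset\mathbb B_d$ for which there is an injective analytic map $f:\mathbb D\to\mathbb B_d$, called an embedding map of $V$, such that $f(\mathbb D)=V$, $f'(z)\ne0$ for all $z\in\mathbb D$, and $f$ extends to a $C^2$ map on $\overline{\mathbb D}$ (again denoted $f$) with $\|f(x)\|=1\iff|x|=1$ for $x\in\overline{\mathbb D}$.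 Put $\mathcal M_f=\{\varphi:\mathbb D\to\mathbb C:\ \varphi\circ f^{-1}\in\mathcal M_V\}$, an algebra under pointwise operations. **Theorem.** Let $V\subset\mathbb B_d$ and $W\subset\mathbb B_e$ ($d,e<\infty$) be analytic discs attached to the unit sphere, with embedding maps $f$ and $g$ respectively. If $\mathcal M_f$ and $\mathcal M_g$ are isomorphic as complex algebras, then $f$ and $g$ have the same self-crossing type: there is a holomorphic automorphism $\mu$ of $\mathbb D$ (extended continuously to $\overline{\mathbb D}$) such that $$f(\xi)=f(\zeta)\iff g(\mu(\xi))=g(\mu(\zeta)),\qquad \xi,\zeta\in\mathbb T.$$ -/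

import Mathlib

open Metric Set

namespace MultDisc

/-- The Hermitian space `ℂ^d`. -/
abbrev CSpace (d : ℕ) : Type := EuclideanSpace ℂ (Fin d)

/-- The open unit ball of `ℂ^d`, as a type. -/
abbrev UnitBall (d : ℕ) : Type := ball (0 : CSpace d) 1

/-- The open unit disc of `ℂ`, as a type. -/
abbrev Disc : Type := ball (0 : ℂ) 1

/-- `|c_α|² α! / |α|!`, the contribution of the coefficient `c_α` of `z^α` to the squared norm of
the Drury-Arveson space. -/
noncomputable def daTerm {d : ℕ} (c : (Fin d → ℕ) → ℂ) (α : Fin d → ℕ) : ℝ :=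
  ‖c α‖ ^ 2 * ((∏ i, ((α i).factorial : ℝ)) / ((∑ i, α i).factorial : ℝ))

/-- `h` is the sum on the unit ball of a power series `∑ c_α z^α` with
`∑ |c_α|² α! / |α|! < ∞`. -/
def MemDruryArveson {d : ℕ} (h : UnitBall d → ℂ) : Prop :=
  ∃ c : (Fin d → ℕ) → ℂ, Summable (daTerm c) ∧
    ∀ z : UnitBall d, HasSum (fun α : Fin d → ℕ => c α * ∏ i, ((z : CSpace d) i) ^ (α i)) (h z)

/-- The Drury-Arveson space `H²_d`, as a vector space of functions on the unit ball. -/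
noncomputable def druryArveson (d : ℕ) : Submodule ℂ (UnitBall d → ℂ) where
  carrier := {h | MemDruryArveson h}
  zero_mem' := by
    refine ⟨0, ?_, fun z => ?_⟩
    · have h0 : daTerm (0 : (Fin d → ℕ) → ℂ) = fun _ => 0 := by
        funext α
        simp [daTerm]
      rw [h0]
      exact summable_zero
    · simp
  add_mem' := by
    rintro h k ⟨c, hc, hch⟩ ⟨e, he, hek⟩
    refine ⟨c + e, ?_, fun z => ?_⟩
    · refine Summable.of_nonneg_of_le (fun α => by unfold daTerm; positivity) (fun α => ?_)
        ((hc.add he).mul_left 2)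
      have hw : (0 : ℝ) ≤ (∏ i, ((α i).factorial : ℝ)) / ((∑ i, α i).factorial : ℝ) := by
        positivity
      have h2 : ‖c α + e α‖ ^ 2 ≤ 2 * (‖c α‖ ^ 2 + ‖e α‖ ^ 2) := by
        have h3 := norm_add_le (c α) (e α)
        nlinarith [norm_nonneg (c α + e α), sq_nonneg (‖c α‖ - ‖e α‖)]
      have h4 := mul_le_mul_of_nonneg_right h2 hw
      simp only [daTerm, Pi.add_apply]
      linarith
    · simpa [add_mul] using (hch z).add (hek z)
  smul_mem' := by
    rintro a h ⟨c, hc, hch⟩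
    refine ⟨a • c, ?_, fun z => ?_⟩
    · have h0 : daTerm (a • c) = fun α => ‖a‖ ^ 2 * daTerm c α := by
        funext α
        simp only [daTerm, Pi.smul_apply, norm_smul]
        ring
      rw [h0]
      exact hc.mul_left _
    · have h1 := (hch z).mul_left a
      simp only [← mul_assoc] at h1
      exact h1

/-- The multiplier algebra `M_d` of the Drury-Arveson space: the functions `φ` on the unit ball
with `φ h ∈ H²_d` for every `h ∈ H²_d`. -/
noncomputable def multiplierAlgebra (d : ℕ) : Subalgebra ℂ (UnitBall d → ℂ) where
  carrier := {φ | ∀ h ∈ druryArveson d, φ * h ∈ druryArveson d}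
  mul_mem' := by
    intro φ ψ hφ hψ h hh
    rw [mul_assoc]
    exact hφ _ (hψ _ hh)
  add_mem' := by
    intro φ ψ hφ hψ h hh
    rw [add_mul]
    exact (druryArveson d).add_mem (hφ _ hh) (hψ _ hh)
  algebraMap_mem' := by
    intro a h hh
    rw [← Algebra.smul_def]
    exact (druryArveson d).smul_mem a hh

/-- `V` is a (multiplier) variety: the joint zero set in the ball of a set of multipliers. -/
def IsVariety {d : ℕ} (V : Set (UnitBall d)) : Prop :=
  ∃ E : Set (UnitBall d → ℂ), E ⊆ multiplierAlgebra d ∧ V = {z | ∀ φ ∈ E, φ z = 0}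

/-- Composition with `p`, as a homomorphism of algebras of complex functions. -/
def compHom {X Y : Type*} (p : X → Y) : (Y → ℂ) →ₐ[ℂ] (X → ℂ) where
  toFun φ := φ ∘ p
  map_one' := rfl
  map_mul' _ _ := rfl
  map_zero' := rfl
  map_add' _ _ := rfl
  commutes' _ := rfl

/-- The algebra `M_V = {φ|_V : φ ∈ M_d}`. -/
noncomputable def varietyAlgebra {d : ℕ} (V : Set (UnitBall d)) : Subalgebra ℂ (V → ℂ) :=
  (multiplierAlgebra d).map (compHom ((↑) : V → UnitBall d))

/-- `V` is an analytic disc attached to the unit sphere and `f` is an embedding map of `V`. Only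
the values of `f` on the closed unit disc matter; there `f` denotes both the map on the open disc
and its (unique) `C²` extension to the closed disc. -/
structure IsEmbeddingMap {d : ℕ} (f : ℂ → CSpace d) (V : Set (UnitBall d)) : Prop where
  isVariety : IsVariety V
  differentiableOn : DifferentiableOn ℂ f (ball 0 1)
  /-- `f` is injective on the open disc, with image `V`. -/
  bijOn : BijOn f (ball 0 1) ((↑) '' V)
  deriv_ne_zero : ∀ z ∈ ball (0 : ℂ) 1, deriv f z ≠ 0
  contDiffOn : ContDiffOn ℝ 2 f (closedBall 0 1)
  norm_eq_one_iff : ∀ x ∈ closedBall (0 : ℂ) 1, ‖f x‖ = 1 ↔ ‖x‖ = 1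

/-- The bijection from the open unit disc onto `V` given by an embedding map of `V`. -/
noncomputable def IsEmbeddingMap.equiv {d : ℕ} {f : ℂ → CSpace d} {V : Set (UnitBall d)}
    (hf : IsEmbeddingMap f V) : Disc ≃ V :=
  hf.bijOn.equiv.trans (Equiv.Set.image _ V Subtype.val_injective).symm

/-- The algebra `M_f` of functions `φ` on the open unit disc with `φ ∘ f⁻¹ ∈ M_V`. -/
noncomputable def IsEmbeddingMap.algebra {d : ℕ} {f : ℂ → CSpace d} {V : Set (UnitBall d)}
    (hf : IsEmbeddingMap f V) : Subalgebra ℂ (Disc → ℂ) :=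
  (varietyAlgebra V).comap (compHom hf.equiv.symm)

/-- `μ` is a holomorphic automorphism of the open unit disc; on the closed disc `μ` denotes its
(unique) continuous extension. -/
structure IsDiscAutomorphism (μ : ℂ → ℂ) : Prop where
  differentiableOn : DifferentiableOn ℂ μ (ball 0 1)
  bijOn : BijOn μ (ball 0 1) (ball 0 1)
  continuousOn : ContinuousOn μ (closedBall 0 1)

/-- `f` and `g` have the same self-crossings on the boundary of the unit disc. -/
def SameSelfCrossings {X Y : Type*} (f : ℂ → X) (g : ℂ → Y) : Prop :=
  ∀ ξ ∈ sphere (0 : ℂ) 1, ∀ ζ ∈ sphere (0 : ℂ) 1, f ξ = f ζ ↔ g ξ = g ζ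

/-- `f` and `g` have the same self-crossing type: the same self-crossings on the boundary up to an
automorphism of the unit disc. -/
def SameSelfCrossingType {X Y : Type*} (f : ℂ → X) (g : ℂ → Y) : Prop :=
  ∃ μ : ℂ → ℂ, IsDiscAutomorphism μ ∧ SameSelfCrossings f (g ∘ μ)

end MultDisc

/-!
Why the theorem holds. An isomorphism of the algebras is the composition with a biholomorphic map
of the disc, and a function of the algebra of `f` that is continuous up to the circle must take
equal values at `ξ` and `ζ` whenever `f ξ = f ζ`. Applied to the coordinates of `g ∘ μ`, which
belong to the algebra of `f`, the second fact shows that `g ∘ μ` inherits the self-crossings of `f`;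
the inverse isomorphism gives the converse.

*Isomorphisms are compositions.* Following an isomorphism by the evaluation at a point `w` of the
disc gives a character of the multiplier algebra of the ball. No continuity is assumed: since
`1 - ⟨z, a⟩` is invertible for `‖a‖ < 1`, every character lies over a point `F w` of the closed
ball (`norm_characterPoint_le_one`), and over a point of the open ball the only character is the
evaluation (`character_apply_eq`). The map `F` is analytic; by the maximum principle it stays in
the open ball, hence in the variety, and lifts through `f` to an analytic map of the disc
(`exists_symbol`, `IsEmbeddingMap.differentiableOn_lift`). The symbols of the isomorphism and of its
inverse are inverse to each other, so they are Möbius maps.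

That fibres over the open ball are trivial is Gleason's problem for multipliers: a multiplier
vanishing at `p` is `∑ (z_i - p_i) ψ_i` with multipliers `ψ_i` (`exists_gleason`). All operator
theory is expressed by positive kernels: `φ` is a multiplier iff `(C - φ(z) conj φ(w)) k(z, w)` is
positive for some `C`, where `k(z, w) = 1 / (1 - ⟨z, w⟩)` (`mem_multiplierAlgebra_iff`). If
`φ p = 0`, the kernel `(C ⟨z - p, w - p⟩ - φ(z) conj φ(w)) k(z, w)` is positive too for a suitable
`C`, by a Schur complement and the Cauchy–Schwarz inequality. It therefore factors as
`⟪γ z, γ w⟫`, and comparing Gram matrices in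
`C ⟨z - p, w - p⟩ + ⟨z, w⟩ ⟪γ z, γ w⟫ = φ(z) conj φ(w) + ⟪γ z, γ w⟫` produces a contraction (the
lurking isometry) whose transfer functions are, up to a constant, the `ψ_i`.

*Boundary values.* Let `f ξ = p` on the sphere. By the Hopf lemma and the complex linearity of the
boundary derivative, `f ((1 - s) ξ) = p - s v + o(s)` with `⟪p, v⟫ = A` real and positive. This
curve and the radial point `(1 - s A) p` differ by `s` times a vector orthogonal to `p`, up to
`o(s)`, while their distance to the sphere is of order `s`; so the complex line through both meets the ball
in a disc that is arbitrarily large compared with their distance. By the Schwarz lemma a bounded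
analytic function takes asymptotically equal values at both. Thus a boundary value of `ψ ∘ f` at `ξ`
is the radial limit of `ψ` at `f ξ` (`IsEmbeddingMap.tendsto_radial`), which depends on `f ξ` only.
-/

namespace MultDisc

/-! ### Positive kernels -/

open scoped ComplexOrder in
/-- A positive (semidefinite) kernel on `X`. The convention is that of `K x y = ⟪v x, v y⟫`. -/
def IsPosKernel {X : Type*} (K : X → X → ℂ) : Prop := (Matrix.of K).PosSemidef

namespace IsPosKernel
open ComplexConjugate ComplexOrder

variable {X : Type} {K L : X → X → ℂ}

theorem congr (h : IsPosKernel K) (e : ∀ x y, K x y = L x y) : IsPosKernel L := by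
  obtain rfl : K = L := funext₂ e
  exact h

theorem finsupp_sum_inner {E : Type*} [NormedAddCommGroup E] [InnerProductSpace ℂ E] (v : X → E)
    (a : X →₀ ℂ) : a.sum (fun i xi ↦ a.sum fun j xj ↦ star xi * inner ℂ (v i) (v j) * xj)
      = ((‖Finsupp.linearCombination ℂ v a‖ ^ 2 : ℝ) : ℂ) := by
  rw [Complex.ofReal_pow]
  refine Eq.trans ?_ (inner_self_eq_norm_sq_to_K (𝕜 := ℂ) (Finsupp.linearCombination ℂ v a))
  simp only [Finsupp.linearCombination_apply, Finsupp.sum]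
  rw [sum_inner]
  refine Finset.sum_congr rfl fun i _ => ?_
  rw [inner_sum]
  refine Finset.sum_congr rfl fun j _ => ?_
  rw [inner_smul_left, inner_smul_right]
  simp only [starRingEnd_apply]
  ring

theorem of_inner {E : Type*} [NormedAddCommGroup E] [InnerProductSpace ℂ E] (v : X → E) :
    IsPosKernel fun x y => inner ℂ (v x) (v y) := by
  refine ⟨?_, fun a => ?_⟩
  · ext x y
    simp [Matrix.conjTranspose_apply]
  · change 0 ≤ (a.sum fun i xi ↦ a.sum fun j xj ↦ star xi * inner ℂ (v i) (v j) * xj)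
    rw [finsupp_sum_inner]
    norm_cast
    positivity

/-- The Kolmogorov decomposition of a positive kernel. -/
theorem exists_inner (h : IsPosKernel K) :
    ∃ (E : Type) (_ : NormedAddCommGroup E) (_ : InnerProductSpace ℂ E) (_ : CompleteSpace E)
      (v : X → E), ∀ x y, K x y = inner ℂ (v x) (v y) := by
  let K' : Matrix X X (ℂ →L[ℂ] ℂ) :=
    Matrix.of fun x y => K x y • 1
  have hK' : K'.PosSemidef := by
    have iff : K'.PosSemidef ↔ K'.IsHermitian ∧ ∀ (a : X →₀ ℂ),
        0 ≤ (a.sum fun x w ↦ a.sum fun x' w' ↦ inner ℂ (K' x' x w) w').re :=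
      RKHS.posSemidef_tfae.out 0 2
    refine iff.mpr ⟨?_, fun a => ?_⟩
    · ext x y
      have := h.1.apply x y
      simp only [Matrix.of_apply] at this
      simp only [K', Matrix.conjTranspose_apply, Matrix.of_apply, star_smul, star_one, this]
    · have e : (a.sum fun x w ↦ a.sum fun x' w' ↦ inner ℂ (K' x' x w) w')
          = a.sum fun i xi ↦ a.sum fun j xj ↦ star xi * K i j * xj := by
        refine Finsupp.sum_congr fun i _ => Finsupp.sum_congr fun j _ => ?_
        have := h.1.apply i j
        simp only [Matrix.of_apply] at this
        simp [K', ← this]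
        ring
      rw [e]
      exact (Complex.le_def.mp (h.2 a)).1
  have : Fact K'.PosSemidef := ⟨hK'⟩
  refine ⟨RKHS.OfKernel K', inferInstance, inferInstance, inferInstance,
    fun x => RKHS.kerFun (RKHS.OfKernel K') x 1, fun x y => ?_⟩
  rw [← ContinuousLinearMap.adjoint_inner_right, ← ContinuousLinearMap.comp_apply,
    ← RKHS.kernel_apply, RKHS.OfKernel.kernel_ofKernel]
  simp [K']

theorem nonneg (h : IsPosKernel K) (a : X →₀ ℂ) :
    0 ≤ a.sum fun i xi ↦ a.sum fun j xj ↦ star xi * K i j * xj := h.2 a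

theorem add (hK : IsPosKernel K) (hL : IsPosKernel L) : IsPosKernel fun x y => K x y + L x y :=
  Matrix.PosSemidef.add hK hL

theorem zero : IsPosKernel fun _ _ : X => 0 := Matrix.PosSemidef.zero

theorem sum {ι : Type*} (s : Finset ι) {K : ι → X → X → ℂ} (h : ∀ i ∈ s, IsPosKernel (K i)) :
    IsPosKernel fun x y => ∑ i ∈ s, K i x y := by
  classical
  induction s using Finset.induction_on with
  | empty => simpa using zero
  | insert i s hi ih =>
    simp only [Finset.sum_insert hi]
    exact (h i (by simp)).add (ih fun j hj => h j (by simp [hj]))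

theorem congruence (h : IsPosKernel K) (g : X → ℂ) :
    IsPosKernel fun x y => g x * conj (g y) * K x y := by
  obtain ⟨E, _, _, _, v, hv⟩ := h.exists_inner
  refine (of_inner fun x => conj (g x) • v x).congr fun x y => ?_
  rw [inner_smul_left, inner_smul_right, hv, Complex.conj_conj, mul_assoc]

theorem rankOne (g : X → ℂ) : IsPosKernel fun x y => g x * conj (g y) := by
  refine (of_inner (fun x => conj (g x))).congr fun x y => ?_
  simp [mul_comm]

theorem const_mul (h : IsPosKernel K) {c : ℝ} (hc : 0 ≤ c) : IsPosKernel fun x y => c * K x y := by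
  refine (h.congruence fun _ => (√c : ℂ)).congr fun x y => ?_
  rw [Complex.conj_ofReal, ← Complex.ofReal_mul, Real.mul_self_sqrt hc]

/-- The Schur product theorem. -/
theorem mul (hK : IsPosKernel K) (hL : IsPosKernel L) :
    IsPosKernel fun x y => K x y * L x y := by
  obtain ⟨E, _, _, _, v, hv⟩ := hK.exists_inner
  obtain ⟨F, _, _, _, u, hu⟩ := hL.exists_inner
  refine (of_inner fun x => TensorProduct.tmul ℂ (v x) (u x)).congr fun x y => ?_
  rw [TensorProduct.inner_tmul, hv, hu]

/-- The Schur complement of a diagonal entry of a positive kernel is positive. -/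
theorem schur_complement (hK : IsPosKernel K) {p : X} {t : ℝ}
    (ht : 0 < t) (hp : K p p = t) :
    IsPosKernel fun x y => K x y - K x p * K p y / t := by
  obtain ⟨E, _, _, _, v, hv⟩ := hK.exists_inner
  refine (of_inner fun x => v x - (inner ℂ (v p) (v x) / t) • v p).congr fun x y => ?_
  have ht' : (t : ℂ) ≠ 0 := by exact_mod_cast ht.ne'
  rw [hv] at hp
  simp only [inner_sub_left, inner_sub_right, inner_smul_left, inner_smul_right, map_div₀,
    inner_conj_symm, hp, hv, Complex.conj_ofReal]
  field_simp
  ring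

theorem finsupp_sum_sub {E F : Type*} [NormedAddCommGroup E] [InnerProductSpace ℂ E]
    [NormedAddCommGroup F] [InnerProductSpace ℂ F] (u : X → E) (v : X → F) (C : ℝ) (a : X →₀ ℂ) :
    (a.sum fun i xi ↦ a.sum fun j xj ↦ star xi *
      ((C : ℂ) ^ 2 * inner ℂ (u i) (u j) - inner ℂ (v i) (v j)) * xj)
      = ((C ^ 2 * ‖Finsupp.linearCombination ℂ u a‖ ^ 2
          - ‖Finsupp.linearCombination ℂ v a‖ ^ 2 : ℝ) : ℂ) := by
  rw [Complex.ofReal_sub, Complex.ofReal_mul, ← finsupp_sum_inner u, ← finsupp_sum_inner v,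
    Complex.ofReal_pow]
  simp only [Finsupp.sum, Finset.mul_sum, ← Finset.sum_sub_distrib]
  refine Finset.sum_congr rfl fun i _ => Finset.sum_congr rfl fun j _ => ?_
  ring

theorem of_norm_le {E F : Type*} [NormedAddCommGroup E] [InnerProductSpace ℂ E]
    [NormedAddCommGroup F] [InnerProductSpace ℂ F] {u : X → E} {v : X → F} {C : ℝ}
    (h : ∀ a : X →₀ ℂ,
      ‖Finsupp.linearCombination ℂ v a‖ ≤ C * ‖Finsupp.linearCombination ℂ u a‖) :
    IsPosKernel fun x y => (C : ℂ) ^ 2 * inner ℂ (u x) (u y) - inner ℂ (v x) (v y) := by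
  refine ⟨?_, fun a => ?_⟩
  · ext x y
    simp [Matrix.conjTranspose_apply]
  · refine (finsupp_sum_sub u v C a).symm ▸ Complex.zero_le_real.mpr ?_
    have := pow_le_pow_left₀ (norm_nonneg _) (h a) 2
    rw [mul_pow] at this
    linarith

theorem of_contraction {E F : Type*} [NormedAddCommGroup E] [InnerProductSpace ℂ E]
    [NormedAddCommGroup F] [InnerProductSpace ℂ F] (u : X → E) {T : E →L[ℂ] F}
    (hT : ∀ y, ‖T y‖ ≤ ‖y‖) :
    IsPosKernel fun x y => inner ℂ (u x) (u y) - inner ℂ (T (u x)) (T (u y)) := by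
  refine (of_norm_le (u := u) (v := fun x => T (u x)) (C := 1) fun a => ?_).congr
    fun x y => by simp
  rw [one_mul]
  refine le_of_eq_of_le ?_ (hT _)
  simp [Finsupp.linearCombination_apply, map_finsuppSum]

theorem comap {Y : Type} (h : IsPosKernel K) (f : Y → X) :
    IsPosKernel fun x y => K (f x) (f y) := h.submatrix f

/-- A dominated family of vectors is the image of the dominating one under a bounded operator. -/
theorem exists_clm {E F : Type*} [NormedAddCommGroup E] [InnerProductSpace ℂ E] [CompleteSpace E]
    [NormedAddCommGroup F] [InnerProductSpace ℂ F] [CompleteSpace F] {u : X → E} {v : X → F}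
    {C : ℝ} (hC : 0 ≤ C)
    (h : IsPosKernel fun x y => (C : ℂ) ^ 2 * inner ℂ (u x) (u y) - inner ℂ (v x) (v y)) :
    ∃ T : E →L[ℂ] F, (∀ x, T (u x) = v x) ∧ ∀ y, ‖T y‖ ≤ C * ‖y‖ := by
  have bound : ∀ a : X →₀ ℂ,
      ‖Finsupp.linearCombination ℂ v a‖ ≤ C * ‖Finsupp.linearCombination ℂ u a‖ := by
    intro a
    have h1 := h.nonneg a
    rw [finsupp_sum_sub, Complex.zero_le_real] at h1
    refine (pow_le_pow_iff_left₀ (norm_nonneg _) (by positivity) two_ne_zero).mp ?_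
    rw [mul_pow]
    linarith
  let S : Submodule ℂ E := (LinearMap.range (Finsupp.linearCombination ℂ u)).topologicalClosure
  have hS : CompleteSpace S := (Submodule.isClosed_topologicalClosure _).completeSpace_coe
  let e : (X →₀ ℂ) →ₗ[ℂ] S := (Finsupp.linearCombination ℂ u).codRestrict S fun a =>
    Submodule.le_topologicalClosure _ (LinearMap.mem_range_self _ a)
  have he : DenseRange e := by
    intro x
    rw [closure_subtype]
    have : (Subtype.val '' range e : Set E) = LinearMap.range (Finsupp.linearCombination ℂ u) := by
      ext y
      simp [e]
    rw [this]
    exact x.2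
  have hb : ∀ a, ‖Finsupp.linearCombination ℂ v a‖ ≤ C * ‖e a‖ := bound
  refine ⟨(LinearMap.extendOfNorm (Finsupp.linearCombination ℂ v) e).comp
    S.orthogonalProjectionOnto, fun x => ?_, fun y => ?_⟩
  · have h1 : S.orthogonalProjectionOnto (u x) = e (Finsupp.single x 1) := by
      have : u x = (e (Finsupp.single x 1) : E) := by simp [e]
      rw [this, Submodule.orthogonalProjectionOnto_mem_subspace_eq_self]
    rw [ContinuousLinearMap.comp_apply, h1, LinearMap.extendOfNorm_eq he ⟨C, hb⟩]
    simp
  · refine (LinearMap.norm_extendOfNorm_apply_le he C hb _).trans ?_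
    gcongr
    exact S.norm_orthogonalProjectionOnto_apply_le y

end IsPosKernel

open ComplexConjugate

/-! ### The Drury–Arveson kernel -/

/-- The multinomial coefficient `|α|! / α!`, as a real number. -/
noncomputable def multinomialWeight {d : ℕ} (α : Fin d → ℕ) : ℝ :=
  ((∑ i, α i).factorial : ℝ) / ∏ i, ((α i).factorial : ℝ)

theorem multinomialWeight_pos {d : ℕ} (α : Fin d → ℕ) : 0 < multinomialWeight α := by
  unfold multinomialWeight
  have : 0 < ∏ i, ((α i).factorial : ℝ) :=
    Finset.prod_pos fun i _ => by exact_mod_cast (α i).factorial_pos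
  have : 0 < ((∑ i, α i).factorial : ℝ) := by exact_mod_cast Nat.factorial_pos _
  positivity

theorem multinomialWeight_eq {d : ℕ} (α : Fin d → ℕ) :
    multinomialWeight α = Nat.multinomial Finset.univ α := by
  have h := Nat.multinomial_spec Finset.univ α
  have h0 : ∏ i, ((α i).factorial : ℝ) ≠ 0 :=
    Finset.prod_ne_zero_iff.mpr fun i _ => by exact_mod_cast (α i).factorial_ne_zero
  rw [multinomialWeight, div_eq_iff h0, mul_comm]
  exact_mod_cast h.symm

/-- Multi-indices, sorted by their length. -/
def sigmaPiAntidiagEquiv (d : ℕ) :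
    (Σ n : ℕ, (Finset.univ : Finset (Fin d)).piAntidiag n) ≃ (Fin d → ℕ) where
  toFun p := p.2.1
  invFun α := ⟨∑ i, α i, α, by simp⟩
  left_inv := by
    rintro ⟨n, α, h⟩
    obtain rfl : ∑ i, α i = n := by simpa using h
    rfl
  right_inv _ := rfl

theorem sum_multinomialWeight_piAntidiag {d : ℕ} {R : Type*} [CommRing R] [Algebra ℝ R]
    (x : Fin d → R) (n : ℕ) :
    ∑ α : (Finset.univ : Finset (Fin d)).piAntidiag n,
      algebraMap ℝ R (multinomialWeight α.1) * ∏ i, x i ^ α.1 i = (∑ i, x i) ^ n := by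
  rw [Finset.sum_coe_sort ((Finset.univ : Finset (Fin d)).piAntidiag n)
    fun α => algebraMap ℝ R (multinomialWeight α) * ∏ i, x i ^ α i,
    Finset.sum_pow_eq_sum_piAntidiag]
  refine Finset.sum_congr rfl fun α _ => ?_
  rw [multinomialWeight_eq, map_natCast]

theorem hasSum_multinomialWeight {d : ℕ} {x : Fin d → ℂ} (hx : ∑ i, ‖x i‖ < 1) :
    HasSum (fun α : Fin d → ℕ => (multinomialWeight α : ℂ) * ∏ i, x i ^ α i) (1 - ∑ i, x i)⁻¹ := by
  have h0 : 0 ≤ ∑ i, ‖x i‖ := Finset.sum_nonneg fun i _ => norm_nonneg _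
  have hs : Summable fun α : Fin d → ℕ => (multinomialWeight α : ℂ) * ∏ i, x i ^ α i := by
    refine Summable.of_norm ?_
    rw [← (sigmaPiAntidiagEquiv d).summable_iff]
    refine (summable_sigma_of_nonneg fun _ => norm_nonneg _).mpr ⟨fun n => ?_, ?_⟩
    · exact (hasSum_fintype _).summable
    · have : ∀ n, ∑' α : (Finset.univ : Finset (Fin d)).piAntidiag n,
          ((fun α : Fin d → ℕ => ‖(multinomialWeight α : ℂ) * ∏ i, x i ^ α i‖) ∘
            sigmaPiAntidiagEquiv d) ⟨n, α⟩ = (∑ i, ‖x i‖) ^ n := by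
        intro n
        rw [tsum_fintype, ← sum_multinomialWeight_piAntidiag (R := ℝ)]
        refine Finset.sum_congr rfl fun α _ => ?_
        simp [sigmaPiAntidiagEquiv, norm_prod, abs_of_pos (multinomialWeight_pos _)]
      exact (summable_geometric_of_lt_one h0 hx).congr fun n => (this n).symm
  have h1 := ((sigmaPiAntidiagEquiv d).hasSum_iff.mpr hs.hasSum).sigma
    (fun n => hasSum_fintype _)
  have h2 : ∀ n, ∑ α : (Finset.univ : Finset (Fin d)).piAntidiag n,
      ((fun α : Fin d → ℕ => (multinomialWeight α : ℂ) * ∏ i, x i ^ α i) ∘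
        sigmaPiAntidiagEquiv d) ⟨n, α⟩ = (∑ i, x i) ^ n := fun n =>
    sum_multinomialWeight_piAntidiag x n
  simp only [h2] at h1
  have h3 := hasSum_geometric_of_norm_lt_one ((norm_sum_le _ _).trans_lt hx)
  rw [h3.unique h1]
  exact hs.hasSum

theorem sum_norm_mul_conj_lt_one {d : ℕ} (z w : UnitBall d) :
    ∑ i, ‖(z : CSpace d) i * conj ((w : CSpace d) i)‖ < 1 := by
  have hz : ‖(z : CSpace d)‖ < 1 := mem_ball_zero_iff.mp z.2
  have hw : ‖(w : CSpace d)‖ < 1 := mem_ball_zero_iff.mp w.2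
  have h1 : ∑ i, ‖(z : CSpace d) i * conj ((w : CSpace d) i)‖
      ≤ ∑ i, (‖(z : CSpace d) i‖ ^ 2 + ‖(w : CSpace d) i‖ ^ 2) / 2 := by
    refine Finset.sum_le_sum fun i _ => ?_
    rw [norm_mul, RCLike.norm_conj]
    nlinarith [sq_nonneg (‖(z : CSpace d) i‖ - ‖(w : CSpace d) i‖)]
  rw [← Finset.sum_div, Finset.sum_add_distrib, ← EuclideanSpace.norm_sq_eq,
    ← EuclideanSpace.norm_sq_eq] at h1
  nlinarith [norm_nonneg (z : CSpace d), norm_nonneg (w : CSpace d)]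

/-- The space `ℓ²(ℕ₀^d)`, a model of the Drury–Arveson space in the orthonormal basis of
normalized monomials. -/
abbrev DAModel (d : ℕ) : Type := lp (fun _ : Fin d → ℕ => ℂ) 2

theorem memℓp_kernelVec {d : ℕ} (z : UnitBall d) :
    Memℓp (fun α : Fin d → ℕ => conj (∏ i, (z : CSpace d) i ^ α i) * (√(multinomialWeight α) : ℂ))
      2 := by
  refine (memℓp_gen_iff (by norm_num)).mpr ?_
  have h := (hasSum_multinomialWeight (sum_norm_mul_conj_lt_one z z)).summable.norm
  refine h.congr fun α => ?_
  rw [ENNReal.toReal_ofNat, Real.rpow_two, norm_mul, norm_mul, mul_pow, RCLike.norm_conj,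
    Complex.norm_real, Complex.norm_real, Real.norm_eq_abs, Real.norm_eq_abs, sq_abs,
    Real.sq_sqrt (multinomialWeight_pos α).le, abs_of_pos (multinomialWeight_pos α), mul_comm]
  congr 1
  simp [norm_prod, mul_pow, Finset.prod_mul_distrib, pow_two]

/-- The reproducing kernel of the Drury–Arveson space at `z`, in the model `ℓ²(ℕ₀^d)`. -/
noncomputable def kernelVec {d : ℕ} (z : UnitBall d) : DAModel d := ⟨_, memℓp_kernelVec z⟩

/-- The pairing `⟨z, w⟩ = ∑ z_i conj(w_i)`. -/
noncomputable def pairing {d : ℕ} (z w : CSpace d) : ℂ := ∑ i, z i * conj (w i)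

/-- The Drury–Arveson kernel `1 / (1 - ⟨z, w⟩)`. -/
noncomputable def daKernel {d : ℕ} (z w : UnitBall d) : ℂ := (1 - pairing (z : CSpace d) w)⁻¹

theorem inner_kernelVec_kernelVec {d : ℕ} (z w : UnitBall d) :
    inner ℂ (kernelVec z) (kernelVec w) = daKernel z w := by
  refine (lp.hasSum_inner (𝕜 := ℂ) (kernelVec z) (kernelVec w)).unique ?_
  refine (hasSum_multinomialWeight (sum_norm_mul_conj_lt_one z w)).congr_fun ?_
  intro α
  have h : (√(multinomialWeight α) : ℂ) * √(multinomialWeight α) = multinomialWeight α := by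
    rw [← Complex.ofReal_mul, Real.mul_self_sqrt (multinomialWeight_pos α).le]
  simp only [kernelVec, RCLike.inner_apply, map_mul, Complex.conj_conj, Complex.conj_ofReal]
  simp only [mul_pow, Finset.prod_mul_distrib, map_prod, map_pow, ← h]
  ring

theorem mem_druryArveson_iff {d : ℕ} {h : UnitBall d → ℂ} :
    h ∈ druryArveson d ↔ ∃ x : DAModel d, ∀ z, h z = inner ℂ (kernelVec z) x := by
  have hw : ∀ α : Fin d → ℕ, (√(multinomialWeight α) : ℂ) ≠ 0 := fun α => by
    exact_mod_cast (Real.sqrt_pos.mpr (multinomialWeight_pos α)).ne'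
  have hterm : ∀ (c : (Fin d → ℕ) → ℂ) α,
      daTerm c α = ‖c α / (√(multinomialWeight α) : ℂ)‖ ^ 2 := by
    intro c α
    rw [norm_div, Complex.norm_real, div_pow, Real.norm_eq_abs, sq_abs,
      Real.sq_sqrt (multinomialWeight_pos α).le, daTerm, multinomialWeight, div_div_eq_mul_div,
      mul_div_assoc]
  constructor
  · rintro ⟨c, hc, hh⟩
    refine ⟨⟨fun α => c α / (√(multinomialWeight α) : ℂ),
      (memℓp_gen_iff (by norm_num)).mpr ?_⟩, fun z => ?_⟩
    · refine hc.congr fun α => ?_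
      rw [hterm, ENNReal.toReal_ofNat, Real.rpow_two]
    · refine (hh z).unique ((lp.hasSum_inner (𝕜 := ℂ) (kernelVec z) _).congr_fun fun α => ?_)
      simp only [kernelVec, RCLike.inner_apply, map_mul, Complex.conj_conj, Complex.conj_ofReal]
      field_simp [hw α]
  · rintro ⟨x, hx⟩
    refine ⟨fun α => x α * √(multinomialWeight α), ?_, fun z => ?_⟩
    · have := (memℓp_gen_iff (by norm_num)).mp (lp.memℓp x)
      refine this.congr fun α => ?_
      rw [hterm, mul_div_cancel_right₀ _ (hw α), ENNReal.toReal_ofNat, Real.rpow_two]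
    · rw [hx]
      refine (lp.hasSum_inner (𝕜 := ℂ) (kernelVec z) x).congr_fun fun α => ?_
      simp only [kernelVec, RCLike.inner_apply, map_mul, Complex.conj_conj, Complex.conj_ofReal]
      ring

/-- A function is a multiplier iff it is bounded in the sense of the kernel: for some `C`, the
kernel `(C - φ(z) conj φ(w)) / (1 - ⟨z, w⟩)` is positive. -/
theorem mem_multiplierAlgebra_iff {d : ℕ} {φ : UnitBall d → ℂ} :
    φ ∈ multiplierAlgebra d ↔ ∃ C : ℝ, 0 ≤ C ∧ IsPosKernel fun z w : UnitBall d =>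
      (C - φ z * conj (φ w)) * daKernel z w := by
  constructor
  · intro hφ
    -- The finite combinations `∑ a_z conj (φ z) k_z` with `‖∑ a_z k_z‖ ≤ 1` are pointwise bounded
    -- as functionals, because `φ h` is again represented by a vector; so they are bounded.
    let L : (UnitBall d →₀ ℂ) → DAModel d := fun a => Finsupp.linearCombination ℂ kernelVec a
    let M : (UnitBall d →₀ ℂ) → DAModel d := fun a =>
      Finsupp.linearCombination ℂ (fun z => conj (φ z) • kernelVec z) a
    obtain ⟨C, hC⟩ := banach_steinhaus
      (g := fun a : {a : UnitBall d →₀ ℂ // ‖L a‖ ≤ 1} => innerSL ℂ (M a.1)) (by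
        intro x
        have h1 : (fun z => inner ℂ (kernelVec z) x) ∈ druryArveson d :=
          mem_druryArveson_iff.mpr ⟨x, fun _ => rfl⟩
        obtain ⟨y, hy⟩ := mem_druryArveson_iff.mp (hφ _ h1)
        refine ⟨‖y‖, fun a => ?_⟩
        have h2 : inner ℂ (M a.1) x = inner ℂ (L a.1) y := by
          simp only [M, L, Finsupp.linearCombination_apply, Finsupp.sum, sum_inner]
          refine Finset.sum_congr rfl fun z _ => ?_
          rw [inner_smul_left, inner_smul_left, inner_smul_left, ← hy z, Complex.conj_conj]
          rfl
        rw [innerSL_apply_apply, h2]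
        refine (norm_inner_le_norm _ _).trans ?_
        exact mul_le_of_le_one_left (norm_nonneg _) a.2)
    have hC0 : 0 ≤ C := (norm_nonneg _).trans (hC ⟨0, by simp [L]⟩)
    have bound : ∀ a, ‖M a‖ ≤ C * ‖L a‖ := by
      intro a
      have main : ∀ t : ℝ, 0 < t → ‖L a‖ ≤ t → ‖M a‖ ≤ C * t := by
        intro t ht hLt
        have h1 := hC ⟨((t⁻¹ : ℝ) : ℂ) • a, by
          simp only [L, map_smul, norm_smul, Complex.norm_real, norm_inv, Real.norm_eq_abs,
            abs_of_pos ht]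
          rw [inv_mul_le_iff₀ ht]
          simpa using hLt⟩
        simp only [M, map_smul, norm_smul, Complex.norm_real, norm_inv, Real.norm_eq_abs,
            abs_of_pos ht, innerSL_apply_norm] at h1
        rwa [inv_mul_le_iff₀ ht, mul_comm] at h1
      refine le_of_forall_pos_le_add fun ε hε => ?_
      refine (main (‖L a‖ + ε / (C + 1)) (by positivity) (by
        have : 0 < ε / (C + 1) := by positivity
        linarith)).trans ?_
      have : C * (ε / (C + 1)) ≤ ε := by
        rw [mul_div_assoc', div_le_iff₀ (by positivity)]
        nlinarith
      linarith
    refine ⟨C ^ 2, by positivity, ?_⟩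
    have hpos : IsPosKernel fun z w : UnitBall d => (C : ℂ) ^ 2 *
        inner ℂ (kernelVec z) (kernelVec w) -
        inner ℂ (conj (φ z) • kernelVec z) (conj (φ w) • kernelVec w) :=
      IsPosKernel.of_norm_le bound
    refine hpos.congr fun z w => ?_
    rw [inner_smul_left, inner_smul_right, inner_kernelVec_kernelVec, Complex.conj_conj]
    push_cast
    ring
  · rintro ⟨C, hC, hpos⟩ h hh
    obtain ⟨x, hx⟩ := mem_druryArveson_iff.mp hh
    obtain ⟨T, hT, -⟩ := IsPosKernel.exists_clm (u := kernelVec)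
      (v := fun z : UnitBall d => conj (φ z) • kernelVec z) (Real.sqrt_nonneg C) (by
        refine hpos.congr fun z w => ?_
        rw [inner_smul_left, inner_smul_right, inner_kernelVec_kernelVec, Complex.conj_conj,
          ← Complex.ofReal_pow, Real.sq_sqrt hC]
        ring)
    refine mem_druryArveson_iff.mpr ⟨T.adjoint x, fun z => ?_⟩
    rw [ContinuousLinearMap.adjoint_inner_right, hT, inner_smul_left, Complex.conj_conj, ← hx]
    rfl

/-! ### Affine multipliers and their inverses -/

section
variable {d : ℕ}

theorem pairing_eq_inner (z w : CSpace d) : pairing z w = inner ℂ w z := by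
  simp [pairing, PiLp.inner_apply]

theorem conj_pairing (z w : CSpace d) : conj (pairing z w) = pairing w z := by
  simp [pairing, mul_comm]

theorem pairing_self (z : CSpace d) : pairing z z = ((‖z‖ ^ 2 : ℝ) : ℂ) := by
  rw [pairing_eq_inner, inner_self_eq_norm_sq_to_K, Complex.ofReal_pow]
  rfl

theorem norm_pairing_le (z w : CSpace d) : ‖pairing z w‖ ≤ ‖z‖ * ‖w‖ := by
  rw [pairing_eq_inner, mul_comm]
  exact norm_inner_le_norm _ _

theorem one_sub_pairing_ne_zero {z w : CSpace d} (hz : ‖z‖ < 1) (hw : ‖w‖ < 1) :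
    1 - pairing z w ≠ 0 := by
  intro h
  have h1 := norm_pairing_le z w
  rw [← sub_eq_zero.mp h, norm_one] at h1
  nlinarith [norm_nonneg z, norm_nonneg w]

theorem isPosKernel_pairing : IsPosKernel fun z w : CSpace d => pairing z w :=
  IsPosKernel.sum Finset.univ fun i _ => IsPosKernel.rankOne fun z : CSpace d => z i

/-- The Cauchy–Schwarz inequality, as the positivity of a kernel. -/
theorem isPosKernel_cauchySchwarz (a : CSpace d) : IsPosKernel fun z w : CSpace d =>
    ((‖a‖ ^ 2 : ℝ) : ℂ) * pairing z w - pairing z a * pairing a w := by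
  rcases eq_or_ne a 0 with rfl | ha
  · exact IsPosKernel.zero.congr fun z w => by simp [pairing]
  have h0 : 0 < ‖a‖ ^ 2 := by positivity
  refine ((isPosKernel_pairing.schur_complement h0 (pairing_self a)).const_mul h0.le).congr
    fun z w => ?_
  have : ((‖a‖ ^ 2 : ℝ) : ℂ) ≠ 0 := by exact_mod_cast h0.ne'
  field_simp

theorem UnitBall.norm_lt (z : UnitBall d) : ‖(z : CSpace d)‖ < 1 := mem_ball_zero_iff.mp z.2

theorem isPosKernel_daKernel : IsPosKernel fun z w : UnitBall d => daKernel z w :=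
  (IsPosKernel.of_inner kernelVec).congr inner_kernelVec_kernelVec

theorem daKernel_mul (z w : UnitBall d) :
    (1 - pairing (z : CSpace d) w) * daKernel z w = 1 :=
  mul_inv_cancel₀ (one_sub_pairing_ne_zero z.norm_lt w.norm_lt)

theorem isPosKernel_linear (a : CSpace d) {r : ℝ} (hr : ‖a‖ ≤ r) :
    IsPosKernel fun z w : UnitBall d =>
      (((r ^ 2 : ℝ) : ℂ) - pairing (z : CSpace d) a * pairing a (w : CSpace d)) * daKernel z w := by
  have h1 := ((isPosKernel_cauchySchwarz a).comap fun z : UnitBall d => (z : CSpace d)).mul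
    isPosKernel_daKernel
  have h2 := (IsPosKernel.rankOne fun _ : UnitBall d => (1 : ℂ)).const_mul (sq_nonneg ‖a‖)
  have h3 : 0 ≤ r ^ 2 - ‖a‖ ^ 2 := by nlinarith [norm_nonneg a]
  refine ((h1.add h2).add (isPosKernel_daKernel.const_mul h3)).congr fun z w => ?_
  have := daKernel_mul z w
  push_cast
  simp only [map_one]
  linear_combination (-(‖a‖ : ℂ) ^ 2) * this

theorem pairing_mem_multiplierAlgebra (a : CSpace d) :
    (fun z : UnitBall d => pairing (z : CSpace d) a) ∈ multiplierAlgebra d := by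
  refine mem_multiplierAlgebra_iff.mpr ⟨‖a‖ ^ 2, by positivity, ?_⟩
  refine (isPosKernel_linear a le_rfl).congr fun z w => ?_
  rw [conj_pairing]

theorem coord_mem_multiplierAlgebra (i : Fin d) :
    (fun z : UnitBall d => (z : CSpace d) i) ∈ multiplierAlgebra d := by
  convert pairing_mem_multiplierAlgebra (EuclideanSpace.single i (1 : ℂ)) using 2 with z
  simp [pairing_eq_inner, EuclideanSpace.inner_single_left]

/-- With `ψ = ⟨·, a⟩`, the identity
`|1 - ψ|² - (1 - r)² = |r - ψ|² / r + (1 - r) / r * (r² - |ψ|²)` shows that `1 - ψ` is bounded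
below in the sense of the kernel. -/
theorem inv_one_sub_pairing_mem_multiplierAlgebra {a : CSpace d} (ha : ‖a‖ < 1) :
    (fun z : UnitBall d => (1 - pairing (z : CSpace d) a)⁻¹) ∈ multiplierAlgebra d := by
  set r : ℝ := (1 + ‖a‖) / 2 with hr
  have hr0 : 0 < r := by positivity
  have hr1 : 0 < 1 - r := by linarith
  have h1 := (isPosKernel_linear (d := d) a (r := r) (by linarith)).const_mul
    (show 0 ≤ (1 - r) / r by positivity)
  have h2 := (isPosKernel_daKernel.congruence
    fun z : UnitBall d => (r : ℂ) - pairing (z : CSpace d) a).const_mul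
      (show 0 ≤ 1 / r by positivity)
  have h3 := ((h1.add h2).congruence
    fun z : UnitBall d => (1 - pairing (z : CSpace d) a)⁻¹).const_mul
      (show 0 ≤ ((1 - r) ^ 2)⁻¹ by positivity)
  refine mem_multiplierAlgebra_iff.mpr ⟨((1 - r) ^ 2)⁻¹, by positivity, h3.congr fun z w => ?_⟩
  have n1 : 1 - pairing (z : CSpace d) a ≠ 0 := one_sub_pairing_ne_zero z.norm_lt ha
  have n2 : 1 - pairing a (w : CSpace d) ≠ 0 := one_sub_pairing_ne_zero ha w.norm_lt
  have n3 : (r : ℂ) ≠ 0 := by exact_mod_cast hr0.ne'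
  have n4 : (1 - r : ℂ) ≠ 0 := by exact_mod_cast hr1.ne'
  simp only [map_sub, map_inv₀, map_one, conj_pairing, Complex.conj_ofReal]
  push_cast
  field_simp
  ring

/-! ### Gleason's problem for multipliers -/

/-- A multiplier vanishing at `p` is dominated by the row `(z_i - p_i)` in the sense of the
kernel. -/
theorem isPosKernel_of_apply_eq_zero {φ : UnitBall d → ℂ} (hφ : φ ∈ multiplierAlgebra d)
    {p : UnitBall d} (hp : φ p = 0) :
    ∃ C : ℝ, 0 ≤ C ∧ IsPosKernel fun z w : UnitBall d =>
      (C * pairing ((z : CSpace d) - (p : CSpace d)) ((w : CSpace d) - (p : CSpace d)) -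
        φ z * conj (φ w)) * daKernel z w := by
  obtain ⟨C₀, hC₀, h0⟩ := mem_multiplierAlgebra_iff.mp
    ((multiplierAlgebra d).mul_mem hφ (inv_one_sub_pairing_mem_multiplierAlgebra p.norm_lt))
  have hC : 0 < C₀ + 1 := by linarith
  have hq : 0 < 1 - ‖(p : CSpace d)‖ ^ 2 := by
    nlinarith [p.norm_lt, norm_nonneg (p : CSpace d)]
  refine ⟨C₀ + 1, hC.le, ?_⟩
  have h1 := (h0.add isPosKernel_daKernel).schur_complement (p := p)
    (t := (C₀ + 1) / (1 - ‖(p : CSpace d)‖ ^ 2)) (by positivity) (by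
      simp only [Pi.mul_apply, hp, daKernel, pairing_self]
      push_cast
      ring)
  have h2 := h1.congruence fun z => 1 - pairing (z : CSpace d) p
  have h3 := (((isPosKernel_cauchySchwarz (p : CSpace d)).comap
    fun z : UnitBall d => (z : CSpace d)).mul isPosKernel_daKernel).const_mul hC.le
  refine (h2.add h3).congr fun z w => ?_
  have n1 : 1 - pairing (z : CSpace d) p ≠ 0 := one_sub_pairing_ne_zero z.norm_lt p.norm_lt
  have n2 : 1 - pairing (p : CSpace d) w ≠ 0 := one_sub_pairing_ne_zero p.norm_lt w.norm_lt
  have n3 : 1 - pairing (z : CSpace d) w ≠ 0 := one_sub_pairing_ne_zero z.norm_lt w.norm_lt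
  have n4 : (1 - (‖(p : CSpace d)‖ : ℂ) ^ 2) ≠ 0 := by exact_mod_cast hq.ne'
  have n5 : (C₀ + 1 : ℂ) ≠ 0 := by exact_mod_cast hC.ne'
  have e : pairing ((z : CSpace d) - (p : CSpace d)) ((w : CSpace d) - (p : CSpace d))
      = pairing (z : CSpace d) w - pairing (z : CSpace d) p - pairing (p : CSpace d) w
        + (‖(p : CSpace d)‖ : ℂ) ^ 2 := by
    have := pairing_self (p : CSpace d)
    push_cast at this
    rw [← this]
    simp only [pairing_eq_inner, inner_sub_left, inner_sub_right]
    ring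
  rw [e]
  simp only [Pi.mul_apply, hp, daKernel, map_sub, map_mul, map_inv₀, map_one, map_zero, zero_mul,
    mul_zero, sub_zero, conj_pairing]
  push_cast
  field_simp
  ring

end

section Colligation
variable {d : ℕ} {E : Type} [NormedAddCommGroup E] [InnerProductSpace ℂ E]

/-- The input space `(ℂ ⊕ E)^d` of the colligation that solves Gleason's problem. -/
abbrev GleasonInput (d : ℕ) (E : Type) [NormedAddCommGroup E] [InnerProductSpace ℂ E] : Type :=
  PiLp 2 fun _ : Fin d => WithLp 2 (ℂ × E)

/-- The vector `(c_i ⊕ conj(z_i) x)_i`. -/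
noncomputable def gleasonVec (z : CSpace d) (c : Fin d → ℂ) (x : E) : GleasonInput d E :=
  WithLp.toLp 2 fun i => WithLp.toLp 2 (c i, conj (z i) • x)

theorem inner_gleasonVec (z w : CSpace d) (b c : Fin d → ℂ) (x y : E) :
    inner ℂ (gleasonVec z b x) (gleasonVec w c y)
      = ∑ i, conj (b i) * c i + pairing z w * inner ℂ x y := by
  simp only [gleasonVec, PiLp.inner_apply, WithLp.prod_inner_apply, inner_smul_left,
    inner_smul_right, RCLike.inner_apply, Complex.conj_conj, Finset.sum_add_distrib, pairing,
    Finset.sum_mul]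
  congr 1
  · exact Finset.sum_congr rfl fun i _ => mul_comm _ _
  · exact Finset.sum_congr rfl fun i _ => by ring

theorem gleasonVec_add (z : CSpace d) (b c : Fin d → ℂ) (x y : E) :
    gleasonVec z (b + c) (x + y) = gleasonVec z b x + gleasonVec z c y := by
  ext i : 1
  simp only [gleasonVec, Pi.add_apply, smul_add, PiLp.add_apply]
  rw [← WithLp.toLp_add]
  rfl

theorem gleasonVec_smul (z : CSpace d) (a : ℂ) (c : Fin d → ℂ) (x : E) :
    gleasonVec z (a • c) (a • x) = a • gleasonVec z c x := by
  ext i : 1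
  simp only [gleasonVec, Pi.smul_apply, PiLp.smul_apply, smul_comm _ a x]
  rw [← WithLp.toLp_smul]
  rfl

theorem norm_gleasonVec_zero (z : CSpace d) (x : E) : ‖gleasonVec z 0 x‖ = ‖z‖ * ‖x‖ := by
  have h := inner_gleasonVec z z 0 0 x x
  rw [inner_self_eq_norm_sq_to_K, inner_self_eq_norm_sq_to_K, pairing_self] at h
  simp only [Pi.zero_apply, mul_zero, Finset.sum_const_zero, zero_add] at h
  have h' : ‖gleasonVec z 0 x‖ ^ 2 = (‖z‖ * ‖x‖) ^ 2 := by
    rw [mul_pow]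
    refine Complex.ofReal_injective ?_
    push_cast at h ⊢
    exact h
  exact (pow_left_inj₀ (norm_nonneg _) (by positivity) two_ne_zero).mp h'

/-- For a contractive colligation `T` and a point `z` of the ball, the feedback equation
`x = (T (c ⊕ conj(z) x)).2` has exactly one solution for each input `c`. -/
theorem existsUnique_feedback [CompleteSpace E] {T : GleasonInput d E →L[ℂ] WithLp 2 (ℂ × E)}
    (hT : ∀ y, ‖T y‖ ≤ ‖y‖) (z : UnitBall d) (c : Fin d → ℂ) :
    ∃! x : E, (T (gleasonVec (z : CSpace d) c x)).snd = x := by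
  have hlip : ∀ x y : E, ‖(T (gleasonVec (z : CSpace d) c x)).snd -
      (T (gleasonVec (z : CSpace d) c y)).snd‖ ≤ ‖(z : CSpace d)‖ * ‖x - y‖ := by
    intro x y
    rw [← WithLp.sub_snd, ← map_sub, ← norm_gleasonVec_zero]
    have : gleasonVec (z : CSpace d) c x - gleasonVec (z : CSpace d) c y
        = gleasonVec (z : CSpace d) 0 (x - y) := by
      rw [sub_eq_iff_eq_add, ← gleasonVec_add]
      simp
    rw [this]
    exact (WithLp.norm_snd_le _ _).trans (hT _)
  have hc : ContractingWith ‖(z : CSpace d)‖₊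
      fun x => (T (gleasonVec (z : CSpace d) c x)).snd := by
    refine ⟨by exact_mod_cast z.norm_lt, LipschitzWith.of_dist_le_mul fun x y => ?_⟩
    rw [dist_eq_norm, dist_eq_norm]
    exact hlip x y
  exact ⟨_, hc.fixedPoint_isFixedPt, fun y hy => hc.fixedPoint_unique hy⟩

/-- The transfer function of a contractive colligation is a multiplier: if
`T (c ⊕ conj(z) x(z)) = conj (φ z) ⊕ x(z)`, then, writing `u(z)` for the inputs,
`(‖c‖² - φ(z) conj φ(w)) k(z, w)` is the sum of `(⟪u(z), u(w)⟫ - ⟪T u(z), T u(w)⟫) k(z, w)` and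
`⟪x(z), x(w)⟫`. -/
theorem transfer_mem_multiplierAlgebra {T : GleasonInput d E →L[ℂ] WithLp 2 (ℂ × E)}
    (hT : ∀ y, ‖T y‖ ≤ ‖y‖) {c : Fin d → ℂ} {x : UnitBall d → E} {φ : UnitBall d → ℂ}
    (hx : ∀ z : UnitBall d,
      T (gleasonVec (z : CSpace d) c (x z)) = WithLp.toLp 2 (conj (φ z), x z)) :
    φ ∈ multiplierAlgebra d := by
  refine mem_multiplierAlgebra_iff.mpr ⟨∑ i, ‖c i‖ ^ 2, by positivity, ?_⟩
  have h1 := (IsPosKernel.of_contraction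
    (fun z : UnitBall d => gleasonVec (z : CSpace d) c (x z)) hT).mul isPosKernel_daKernel
  refine (h1.add (IsPosKernel.of_inner x)).congr fun z w => ?_
  have e : ∑ i, conj (c i) * c i = ((∑ i, ‖c i‖ ^ 2 : ℝ) : ℂ) := by
    push_cast
    exact Finset.sum_congr rfl fun i _ => Complex.conj_mul' (c i)
  have := daKernel_mul z w
  rw [hx, hx, inner_gleasonVec, e, WithLp.prod_inner_apply]
  simp only [RCLike.inner_apply, Complex.conj_conj]
  linear_combination (-inner ℂ (x z) (x w)) * this

end Colligation

/-- Gleason's problem is solvable in the multiplier algebra: a multiplier vanishing at `p` lies in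
the ideal generated by the functions `z_i - p_i`. The kernel that expresses the domination of `φ` by
these functions factors; equality of Gram matrices then yields a partial isometry, whose transfer
functions are the required multipliers. -/
theorem exists_gleason {d : ℕ} {φ : UnitBall d → ℂ} (hφ : φ ∈ multiplierAlgebra d)
    {p : UnitBall d} (hp : φ p = 0) :
    ∃ ψ : Fin d → UnitBall d → ℂ, (∀ i, ψ i ∈ multiplierAlgebra d) ∧
      ∀ z, φ z = ∑ i, ((z : CSpace d) i - (p : CSpace d) i) * ψ i z := by
  obtain ⟨C, hC, hpos⟩ := isPosKernel_of_apply_eq_zero hφ hp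
  obtain ⟨E, _, _, _, γ, hγ⟩ := hpos.exists_inner
  let a : UnitBall d → Fin d → ℂ := fun z i =>
    √C * conj ((z : CSpace d) i - (p : CSpace d) i)
  have ha : ∀ z w, ∑ i, conj (a z i) * a w i
      = C * pairing ((z : CSpace d) - (p : CSpace d)) ((w : CSpace d) - (p : CSpace d)) := by
    intro z w
    rw [pairing, Finset.mul_sum]
    refine Finset.sum_congr rfl fun i _ => ?_
    have : (√C : ℂ) * √C = C := by rw [← Complex.ofReal_mul, Real.mul_self_sqrt hC]
    simp only [a, map_mul, Complex.conj_conj, Complex.conj_ofReal, PiLp.sub_apply, ← this]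
    ring
  obtain ⟨T, hTv, hT⟩ := IsPosKernel.exists_clm
    (u := fun z : UnitBall d => gleasonVec (z : CSpace d) (a z) (γ z))
    (v := fun z : UnitBall d => (WithLp.toLp 2 (conj (φ z), γ z) : WithLp 2 (ℂ × E)))
    zero_le_one (by
      refine IsPosKernel.zero.congr fun z w => ?_
      rw [inner_gleasonVec, WithLp.prod_inner_apply, ha]
      simp only [RCLike.inner_apply, Complex.conj_conj, ← hγ]
      have := daKernel_mul z w
      push_cast
      linear_combination (C * pairing ((z : CSpace d) - (p : CSpace d))
        ((w : CSpace d) - (p : CSpace d)) - φ z * conj (φ w)) * this)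
  simp only [one_mul] at hT
  choose x hx using fun (i : Fin d) (z : UnitBall d) =>
    (existsUnique_feedback hT z (Pi.single i 1)).exists
  refine ⟨fun i z => √C * conj (T (gleasonVec (z : CSpace d) (Pi.single i 1) (x i z))).fst,
    fun i => ?_, fun z => ?_⟩
  · refine (multiplierAlgebra d).smul_mem (x := fun z : UnitBall d =>
      conj (T (gleasonVec (z : CSpace d) (Pi.single i 1) (x i z))).fst) ?_ (√C : ℂ)
    refine transfer_mem_multiplierAlgebra hT (c := Pi.single i 1) (x := x i) fun z => ?_
    rw [Complex.conj_conj]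
    exact WithLp.ofLp_injective 2 (Prod.ext rfl (hx i z))
  · -- By linearity, the solutions for the unit vectors combine to the solution for `a z`.
    have hsum : gleasonVec (z : CSpace d) (a z) (∑ i, a z i • x i z)
        = ∑ i, a z i • gleasonVec (z : CSpace d) (Pi.single i 1) (x i z) := by
      have := map_sum
        (AddMonoidHom.mk' (fun q : (Fin d → ℂ) × E => gleasonVec (z : CSpace d) q.1 q.2)
          fun q q' => gleasonVec_add _ _ _ _ _)
        (fun i => a z i • ((Pi.single i 1 : Fin d → ℂ), x i z)) Finset.univ
      simp only [AddMonoidHom.mk'_apply, Prod.smul_fst, Prod.smul_snd, gleasonVec_smul] at this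
      rw [← this, Prod.fst_sum, Prod.snd_sum]
      congr 1
      simp only [Prod.smul_fst]
      exact (pi_eq_sum_univ' (a z)).trans (by simp)
    have hfix : (T (gleasonVec (z : CSpace d) (a z) (∑ i, a z i • x i z))).snd
        = ∑ i, a z i • x i z := by
      rw [hsum, map_sum]
      simp only [map_smul]
      have := map_sum (WithLp.sndL 2 ℂ ℂ E) (fun i => a z i •
        T (gleasonVec (z : CSpace d) (Pi.single i 1) (x i z))) Finset.univ
      simp only [map_smul] at this
      refine this.trans (Finset.sum_congr rfl fun i _ => ?_)
      exact congrArg _ (hx i z)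
    have hγz : γ z = ∑ i, a z i • x i z :=
      (existsUnique_feedback hT z (a z)).unique (congrArg WithLp.snd (hTv z)) hfix
    have h1 := hTv z
    rw [hγz, hsum, map_sum] at h1
    have h2 := map_sum (WithLp.fstL 2 ℂ ℂ E) (fun i =>
        T (a z i • gleasonVec (z : CSpace d) (Pi.single i 1) (x i z))) Finset.univ
    rw [h1] at h2
    have h3 := congrArg conj h2
    simp only [map_sum, map_smul] at h3
    refine Eq.trans ?_ (h3.trans (Finset.sum_congr rfl fun i _ => ?_))
    · exact (Complex.conj_conj _).symm
    · simp only [smul_eq_mul, map_mul, a, Complex.conj_conj, Complex.conj_ofReal]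
      change _ * conj (T (gleasonVec (z : CSpace d) (Pi.single i 1) (x i z))).fst = _
      ring

open Filter Topology

/-! ### Characters of the multiplier algebra -/

section Characters
variable {d : ℕ}

/-- The coordinate functions, as multipliers. -/
noncomputable def coordMultiplier (i : Fin d) : multiplierAlgebra d :=
  ⟨fun z => (z : CSpace d) i, coord_mem_multiplierAlgebra i⟩

/-- The point `(χ(z_1), …, χ(z_d))` over which a character `χ` of the multiplier algebra lies. -/
noncomputable def characterPoint (χ : multiplierAlgebra d →ₐ[ℂ] ℂ) : CSpace d :=
  WithLp.toLp 2 fun i => χ (coordMultiplier i)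

theorem norm_characterPoint_le_one (χ : multiplierAlgebra d →ₐ[ℂ] ℂ) :
    ‖characterPoint χ‖ ≤ 1 := by
  by_contra! h
  set p := characterPoint χ with hp
  have h0 : 0 < ‖p‖ := by linarith
  -- The affine function `1 - ⟨z, p⟩ / ‖p‖²` vanishes at `p` but is invertible.
  let a : CSpace d := (((‖p‖ ^ 2)⁻¹ : ℝ) : ℂ) • p
  have ha : ‖a‖ < 1 := by
    rw [norm_smul, Complex.norm_real, norm_inv, norm_pow, norm_norm, pow_two, mul_inv, mul_assoc,
      inv_mul_cancel₀ h0.ne', mul_one]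
    exact inv_lt_one_of_one_lt₀ h
  let m : multiplierAlgebra d := 1 - ∑ i, conj (a i) • coordMultiplier i
  let n : multiplierAlgebra d := ⟨_, inv_one_sub_pairing_mem_multiplierAlgebra ha⟩
  have hmn : m * n = 1 := by
    ext z
    have e : (m : UnitBall d → ℂ) z = 1 - pairing (z : CSpace d) a := by
      simp [m, pairing, coordMultiplier, mul_comm]
    change (m : UnitBall d → ℂ) z * (1 - pairing (z : CSpace d) a)⁻¹ = 1
    rw [e, mul_inv_cancel₀ (one_sub_pairing_ne_zero z.norm_lt ha)]
  have hm : χ m = 0 := by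
    have e : χ m = 1 - pairing p a := by
      simp [m, pairing, hp, characterPoint, mul_comm]
    have h2 : pairing p a = 1 := by
      have h3 := pairing_self p
      rw [pairing_eq_inner] at h3 ⊢
      rw [inner_smul_left, h3, Complex.conj_ofReal, ← Complex.ofReal_mul,
        inv_mul_cancel₀ (by positivity), Complex.ofReal_one]
    rw [e, h2, sub_self]
  have := congrArg χ hmn
  rw [map_mul, hm, zero_mul, map_one] at this
  exact zero_ne_one this

/-- The only character over a point of the open ball is the evaluation at this point. -/
theorem character_apply_eq {χ : multiplierAlgebra d →ₐ[ℂ] ℂ} {p : UnitBall d}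
    (hp : characterPoint χ = p) (φ : multiplierAlgebra d) : χ φ = φ.1 p := by
  have hmem : (φ - algebraMap ℂ _ (φ.1 p) : multiplierAlgebra d).1 p = 0 := by simp
  obtain ⟨ψ, hψ, h⟩ := exists_gleason (φ - algebraMap ℂ _ (φ.1 p) : multiplierAlgebra d).2 hmem
  have e : φ - algebraMap ℂ _ (φ.1 p)
      = ∑ i, (coordMultiplier i - algebraMap ℂ _ ((p : CSpace d) i)) *
        (⟨ψ i, hψ i⟩ : multiplierAlgebra d) := by
    ext z
    rw [h z]
    simp [coordMultiplier]
  have hc : ∀ i, χ (coordMultiplier i) = (p : CSpace d) i := fun i => by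
    rw [← hp]
    rfl
  have := congrArg χ e
  simp only [map_sub, map_sum, map_mul, AlgHom.commutes, Algebra.algebraMap_self, RingHom.id_apply,
    hc, sub_self, zero_mul, Finset.sum_const_zero] at this
  exact sub_eq_zero.mp this

end Characters

/-! ### Multipliers as bounded analytic functions -/

section Analytic
variable {d : ℕ}

theorem exists_norm_le_of_mem_multiplierAlgebra {φ : UnitBall d → ℂ}
    (hφ : φ ∈ multiplierAlgebra d) : ∃ M : ℝ, ∀ z, ‖φ z‖ ≤ M := by
  obtain ⟨C, hC, h⟩ := mem_multiplierAlgebra_iff.mp hφ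
  refine ⟨√C, fun z => Real.le_sqrt_of_sq_le ?_⟩
  have h1 := h.nonneg (Finsupp.single z 1)
  have h2 : (0 : ℝ) < 1 - ‖(z : CSpace d)‖ ^ 2 := by
    nlinarith [z.norm_lt, norm_nonneg (z : CSpace d)]
  have h3 : (C - φ z * conj (φ z)) * daKernel z z
      = (((C - ‖φ z‖ ^ 2) * (1 - ‖(z : CSpace d)‖ ^ 2)⁻¹ : ℝ) : ℂ) := by
    rw [daKernel, pairing_self, Complex.mul_conj']
    push_cast
    ring
  simp only [Finsupp.sum_single_index, star_one, one_mul, mul_one, zero_mul, star_zero, mul_zero,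
    h3, Complex.zero_le_real] at h1
  have := (mul_nonneg_iff_of_pos_right (inv_pos.mpr h2)).mp h1
  linarith

theorem mem_druryArveson_of_mem_multiplierAlgebra {φ : UnitBall d → ℂ}
    (hφ : φ ∈ multiplierAlgebra d) : φ ∈ druryArveson d := by
  have h1 : (1 : UnitBall d → ℂ) ∈ druryArveson d :=
    mem_druryArveson_iff.mpr ⟨kernelVec ⟨0, by simp⟩, fun z => by
      simp [inner_kernelVec_kernelVec, daKernel, pairing]⟩
  simpa using hφ 1 h1

theorem norm_kernelVec_sq (z : UnitBall d) :
    ‖kernelVec z‖ ^ 2 = (1 - ‖(z : CSpace d)‖ ^ 2)⁻¹ := by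
  have h := inner_kernelVec_kernelVec z z
  rw [inner_self_eq_norm_sq_to_K, daKernel, pairing_self] at h
  refine Complex.ofReal_injective ?_
  push_cast at h ⊢
  exact h

open Classical in
/-- A function on the unit ball, extended by zero to `ℂ^d`. -/
noncomputable def extendZero (φ : UnitBall d → ℂ) (z : CSpace d) : ℂ :=
  if h : z ∈ ball 0 1 then φ ⟨z, h⟩ else 0

theorem extendZero_of_mem (φ : UnitBall d → ℂ) {z : CSpace d} (h : z ∈ ball 0 1) :
    extendZero φ z = φ ⟨z, h⟩ := dif_pos h

/-- Functions in the Drury–Arveson space are analytic along analytic maps `q` of one variable. The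
vectors `x` for which `⟪k_{q(·)}, x⟫` is analytic form a closed subspace that contains the kernel
vectors and all vectors orthogonal to them. -/
theorem differentiableOn_extendZero_comp {h : UnitBall d → ℂ} (hh : h ∈ druryArveson d)
    {U : Set ℂ} (hU : IsOpen U) {q : ℂ → CSpace d} (hq : DifferentiableOn ℂ q U)
    (hm : MapsTo q U (ball 0 1)) : DifferentiableOn ℂ (fun ζ => extendZero h (q ζ)) U := by
  obtain ⟨x, hx⟩ := mem_druryArveson_iff.mp hh
  let G : DAModel d → ℂ → ℂ := fun y ζ => extendZero (fun z => inner ℂ (kernelVec z) y) (q ζ)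
  have hG : ∀ y, ∀ ζ (hζ : ζ ∈ U), G y ζ = inner ℂ (kernelVec ⟨q ζ, hm hζ⟩) y := fun y ζ hζ =>
    extendZero_of_mem _ (hm hζ)
  let S : Submodule ℂ (DAModel d) :=
    { carrier := {y | DifferentiableOn ℂ (G y) U}
      zero_mem' := (differentiableOn_const 0).congr fun ζ hζ => by rw [hG _ _ hζ, inner_zero_right]
      add_mem' := fun {a b} ha hb => (ha.add hb).congr fun ζ hζ => by
        simp [hG _ _ hζ]
      smul_mem' := fun c a ha => (ha.const_mul c).congr fun ζ hζ => by
        simp [hG _ _ hζ] }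
  have hker : ∀ w, kernelVec w ∈ S := by
    intro w
    have : DifferentiableOn ℂ (fun ζ => (1 - inner ℂ (w : CSpace d) (q ζ))⁻¹) U := by
      refine DifferentiableOn.inv ((differentiableOn_const 1).sub ?_) fun ζ hζ => ?_
      · exact (innerSL ℂ (w : CSpace d)).differentiable.comp_differentiableOn hq
      · rw [← pairing_eq_inner]
        exact one_sub_pairing_ne_zero (mem_ball_zero_iff.mp (hm hζ)) w.norm_lt
    refine this.congr fun ζ hζ => ?_
    rw [hG _ _ hζ, inner_kernelVec_kernelVec, daKernel, pairing_eq_inner]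
  have hclosed : IsClosed (S : Set (DAModel d)) := by
    refine isSeqClosed_iff_isClosed.mp fun y y₀ hy hlim => ?_
    have hloc : TendstoLocallyUniformlyOn (fun n => G (y n)) (G y₀) atTop U := by
      refine Metric.tendstoLocallyUniformlyOn_iff.mpr fun ε hε ζ₀ hζ₀ => ?_
      obtain ⟨ρ, h1, h2⟩ := exists_between (mem_ball_zero_iff.mp (hm hζ₀))
      have hρ : 0 < 1 - ρ ^ 2 := by nlinarith [norm_nonneg (q ζ₀)]
      refine ⟨{ζ | ζ ∈ U ∧ ‖q ζ‖ < ρ}, ?_, ?_⟩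
      · exact Filter.inter_mem self_mem_nhdsWithin
          ((hq.continuousOn ζ₀ hζ₀).norm (isOpen_Iio.mem_nhds h1))
      have hlim' : Tendsto (fun n => √((1 - ρ ^ 2)⁻¹) * ‖y₀ - y n‖) atTop (𝓝 0) := by
        have := ((tendsto_const_nhds (x := y₀)).sub hlim).norm.const_mul (√((1 - ρ ^ 2)⁻¹))
        simpa using this
      filter_upwards [hlim'.eventually_lt_const hε] with n hn ζ hζ
      refine lt_of_le_of_lt ?_ hn
      rw [hG _ _ hζ.1, hG _ _ hζ.1, dist_eq_norm, ← inner_sub_right]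
      refine (norm_inner_le_norm _ _).trans ?_
      gcongr
      refine Real.le_sqrt_of_sq_le ?_
      rw [norm_kernelVec_sq]
      have := hζ.2
      gcongr
    exact hloc.differentiableOn (.of_forall hy) hU
  have hSc : CompleteSpace S := hclosed.completeSpace_coe
  have htop : S = ⊤ := by
    refine (Submodule.orthogonal_eq_bot_iff).mp (eq_bot_iff.mpr fun y hy => ?_)
    -- A vector orthogonal to `S` is orthogonal to all kernel vectors, hence belongs to `S`.
    have : y ∈ S := (differentiableOn_const 0).congr fun ζ hζ => by
      rw [hG _ _ hζ]
      exact (Submodule.mem_orthogonal S y).mp hy _ (hker _)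
    exact inner_self_eq_zero.mp ((Submodule.mem_orthogonal S y).mp hy y this)
  have : x ∈ S := htop ▸ Submodule.mem_top
  refine DifferentiableOn.congr this fun ζ hζ => ?_
  rw [hG _ _ hζ, extendZero_of_mem _ (hm hζ), hx]

end Analytic

/-! ### Automorphisms of the disc -/

/-- The Möbius map `z ↦ (z + a) / (1 + conj(a) z)`. -/
noncomputable def mobius (a z : ℂ) : ℂ := (z + a) / (1 + conj a * z)

theorem mobius_denom_ne_zero {a z : ℂ} (ha : ‖a‖ < 1) (hz : ‖z‖ ≤ 1) : 1 + conj a * z ≠ 0 := by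
  intro h
  have h1 : ‖conj a * z‖ = 1 := by
    rw [← norm_neg, ← eq_neg_of_add_eq_zero_left h, norm_one]
  rw [norm_mul, RCLike.norm_conj] at h1
  nlinarith [norm_nonneg a, norm_nonneg z]

theorem differentiableOn_mobius {a : ℂ} (ha : ‖a‖ < 1) :
    DifferentiableOn ℂ (mobius a) (closedBall 0 1) := by
  refine DifferentiableOn.div (by fun_prop) (by fun_prop) fun z hz => ?_
  exact mobius_denom_ne_zero ha (mem_closedBall_zero_iff.mp hz)

theorem norm_mobius_lt_one {a z : ℂ} (ha : ‖a‖ < 1) (hz : ‖z‖ < 1) : ‖mobius a z‖ < 1 := by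
  have h0 := mobius_denom_ne_zero ha hz.le
  rw [mobius, norm_div, div_lt_one (norm_pos_iff.mpr h0)]
  refine (pow_lt_pow_iff_left₀ (norm_nonneg _) (norm_nonneg _) two_ne_zero).mp ?_
  have e : ‖1 + conj a * z‖ ^ 2 - ‖z + a‖ ^ 2 = (1 - ‖a‖ ^ 2) * (1 - ‖z‖ ^ 2) := by
    simp only [← Complex.normSq_eq_norm_sq, Complex.normSq_apply, Complex.add_re, Complex.add_im,
      Complex.mul_re, Complex.mul_im, Complex.conj_re, Complex.conj_im, Complex.one_re,
      Complex.one_im]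
    ring
  have h1 : 0 < 1 - ‖a‖ ^ 2 := by nlinarith [norm_nonneg a]
  have h2 : 0 < 1 - ‖z‖ ^ 2 := by nlinarith [norm_nonneg z]
  nlinarith [mul_pos h1 h2]

theorem mobius_neg_mobius {a z : ℂ} (ha : ‖a‖ < 1) (hz : ‖z‖ < 1) :
    mobius (-a) (mobius a z) = z := by
  have h0 := mobius_denom_ne_zero ha hz.le
  have h2 : 1 + conj (-a) * ((z + a) / (1 + conj a * z)) ≠ 0 :=
    mobius_denom_ne_zero (by simpa using ha) (norm_mobius_lt_one ha hz).le
  have h3 : (z + a) / (1 + conj a * z) * (1 + conj a * z) = z + a := div_mul_cancel₀ _ h0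
  unfold mobius
  rw [div_eq_iff h2, map_neg]
  linear_combination h3

/-- A biholomorphic self-map of the disc is a Möbius map up to a rotation, hence extends
continuously to the closed disc. -/
theorem exists_continuousOn_extension {μ ν : ℂ → ℂ} (hμ : DifferentiableOn ℂ μ (ball 0 1))
    (hν : DifferentiableOn ℂ ν (ball 0 1)) (mμ : MapsTo μ (ball 0 1) (ball 0 1))
    (mν : MapsTo ν (ball 0 1) (ball 0 1)) (h : ∀ z ∈ ball (0 : ℂ) 1, ν (μ z) = z) :
    ∃ m : ℂ → ℂ, ContinuousOn m (closedBall 0 1) ∧ EqOn m μ (ball 0 1) := by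
  have h0 : (0 : ℂ) ∈ ball (0 : ℂ) 1 := by simp
  set a := μ 0 with hadef
  have ha : ‖a‖ < 1 := mem_ball_zero_iff.mp (mμ h0)
  have ha' : ‖-a‖ < 1 := by simpa using ha
  have mm : ∀ {b : ℂ}, ‖b‖ < 1 → MapsTo (mobius b) (ball 0 1) (ball 0 1) := fun hb z hz =>
    mem_ball_zero_iff.mpr (norm_mobius_lt_one hb (mem_ball_zero_iff.mp hz))
  let H : ℂ → ℂ := fun z => mobius (-a) (μ z)
  let K : ℂ → ℂ := fun z => ν (mobius a z)
  have mH : MapsTo H (ball 0 1) (ball 0 1) := (mm ha').comp mμ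
  have mK : MapsTo K (ball 0 1) (ball 0 1) := mν.comp (mm ha)
  have dH : DifferentiableOn ℂ H (ball 0 1) :=
    ((differentiableOn_mobius ha').mono ball_subset_closedBall).comp hμ mμ
  have dK : DifferentiableOn ℂ K (ball 0 1) :=
    hν.comp ((differentiableOn_mobius ha).mono ball_subset_closedBall) (mm ha)
  have H0 : H 0 = 0 := by simp [H, ← hadef, mobius]
  have K0 : K 0 = 0 := by
    have : K 0 = ν (μ 0) := by simp [K, mobius, hadef]
    rw [this, h 0 h0]
  have KH : ∀ z ∈ ball (0 : ℂ) 1, K (H z) = z := by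
    intro z hz
    have := mobius_neg_mobius ha' (mem_ball_zero_iff.mp (mμ hz))
    rw [neg_neg] at this
    simp only [K, H, this, h z hz]
  have key : ∀ z ∈ ball (0 : ℂ) 1, ‖H z‖ = ‖z‖ := by
    intro z hz
    refine le_antisymm ?_ ?_
    · exact Complex.norm_le_norm_of_mapsTo_ball dH (mH.mono_right ball_subset_closedBall) H0
        (mem_ball_zero_iff.mp hz)
    · have := Complex.norm_le_norm_of_mapsTo_ball dK (mK.mono_right ball_subset_closedBall) K0
        (mem_ball_zero_iff.mp (mH hz))
      rwa [KH z hz] at this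
  have hhalf : (1 / 2 : ℂ) ∈ ball (0 : ℂ) 1 := by
    rw [mem_ball_zero_iff]
    norm_num
  have lin := Complex.affine_of_mapsTo_ball_of_norm_dslope_eq_div (f := H) (c := 0) (R₁ := 1)
    (R₂ := 1) (z₀ := 1 / 2) dH (by rw [H0]; exact mH.mono_right ball_subset_closedBall) hhalf (by
      rw [dslope_of_ne _ (by norm_num), slope_def_field, H0, sub_zero, sub_zero, norm_div,
        key _ hhalf]
      norm_num)
  set c := dslope H 0 (1 / 2) with hc
  have hcn : ‖c‖ ≤ 1 := by
    have h1 := lin hhalf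
    have h2 := key _ hhalf
    rw [h1] at h2
    simp only [H0, zero_add, sub_zero, smul_eq_mul, norm_mul] at h2
    norm_num at h2
    linarith
  have hcz : ∀ z : ℂ, ‖z‖ ≤ 1 → ‖c * z‖ ≤ 1 := fun z hz => by
    rw [norm_mul]
    exact mul_le_one₀ hcn (norm_nonneg _) hz
  refine ⟨fun z => mobius a (c * z), ?_, fun z hz => ?_⟩
  · refine (differentiableOn_mobius ha).continuousOn.comp (by fun_prop) fun z hz => ?_
    exact mem_closedBall_zero_iff.mpr (hcz z (mem_closedBall_zero_iff.mp hz))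
  · have h1 := lin hz
    simp only [H0, zero_add, sub_zero, smul_eq_mul] at h1
    have := mobius_neg_mobius ha' (mem_ball_zero_iff.mp (mμ hz))
    rw [neg_neg] at this
    change mobius a (c * z) = μ z
    rw [mul_comm, ← h1]
    exact this

/-! ### Maps between embedded discs -/

section Embedding
variable {d : ℕ} {V : Set (UnitBall d)} {f : ℂ → CSpace d}

/-- The lift of an analytic map through an embedding map is analytic: the embedding map is proper
and immersive. -/
theorem IsEmbeddingMap.differentiableOn_lift (hf : IsEmbeddingMap f V) {F : ℂ → CSpace d}
    {μ : ℂ → ℂ} (hF : DifferentiableOn ℂ F (ball 0 1)) (mμ : MapsTo μ (ball 0 1) (ball 0 1))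
    (h : ∀ z ∈ ball (0 : ℂ) 1, f (μ z) = F z) : DifferentiableOn ℂ μ (ball 0 1) := by
  intro w hw
  refine DifferentiableAt.differentiableWithinAt ?_
  have hnhds : ball (0 : ℂ) 1 ∈ 𝓝 w := isOpen_ball.mem_nhds hw
  have hFw : ‖F w‖ ≠ 1 := by
    rw [← h w hw]
    intro h1
    have := (hf.norm_eq_one_iff _ (ball_subset_closedBall (mμ hw))).mp h1
    exact (mem_ball_zero_iff.mp (mμ hw)).ne this
  have hcont : Tendsto μ (𝓝 w) (𝓝 (μ w)) := by
    refine (isCompact_closedBall (0 : ℂ) 1).tendsto_nhds_of_unique_mapClusterPt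
      (by filter_upwards [hnhds] with z hz using ball_subset_closedBall (mμ hz)) ?_
    intro y hy hcl
    have h1 : Tendsto f (𝓝 y ⊓ map μ (𝓝 w)) (𝓝 (f y)) := by
      refine (hf.contDiffOn.continuousOn y hy).mono_left (inf_le_inf_left _ ?_)
      refine le_principal_iff.mpr (mem_map.mpr ?_)
      filter_upwards [hnhds] with z hz using ball_subset_closedBall (mμ hz)
    have h2 := hcl.tendsto_comp' h1
    have h3 : Tendsto (f ∘ μ) (𝓝 w) (𝓝 (F w)) := by
      refine ((hF.differentiableAt hnhds).continuousAt.tendsto).congr' ?_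
      filter_upwards [hnhds] with z hz using (h z hz).symm
    have h4 : f y = F w := by
      have := h2.clusterPt.mono h3
      exact (eq_of_nhds_neBot this)
    have hyb : y ∈ ball (0 : ℂ) 1 := by
      rw [mem_ball_zero_iff]
      refine lt_of_le_of_ne (mem_closedBall_zero_iff.mp hy) fun h5 => hFw ?_
      rw [← h4]
      exact (hf.norm_eq_one_iff y hy).mpr h5
    exact hf.bijOn.injOn hyb (mμ hw) (h4.trans (h w hw).symm)
  obtain ⟨i, hi⟩ : ∃ i, deriv f (μ w) i ≠ 0 := by
    by_contra! h0
    exact hf.deriv_ne_zero _ (mμ hw) (PiLp.ext h0)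
  have hfd : DifferentiableOn ℂ (fun z => f z i) (ball 0 1) :=
    (EuclideanSpace.proj i : CSpace d →L[ℂ] ℂ).differentiable.comp_differentiableOn
      hf.differentiableOn
  have hderiv : deriv (fun z => f z i) (μ w) = deriv f (μ w) i := by
    have h1 := (hf.differentiableOn.differentiableAt (isOpen_ball.mem_nhds (mμ hw))).hasDerivAt
    exact ((EuclideanSpace.proj i : CSpace d →L[ℂ] ℂ).hasFDerivAt.comp_hasDerivAt _ h1).deriv
  have hs : HasStrictDerivAt (fun z => f z i) (deriv (fun z => f z i) (μ w)) (μ w) :=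
    (hfd.analyticAt (isOpen_ball.mem_nhds (mμ hw))).hasStrictDerivAt
  have hne : deriv (fun z => f z i) (μ w) ≠ 0 := hderiv ▸ hi
  have hFi : DifferentiableAt ℂ (fun z => F z i) w :=
    (EuclideanSpace.proj i : CSpace d →L[ℂ] ℂ).differentiableAt.comp w (hF.differentiableAt hnhds)
  have hloc := (hs.hasStrictFDerivAt_equiv hne).eventually_left_inverse
  have hinv := (hs.to_localInverse hne).hasDerivAt.differentiableAt
  have hcomp : DifferentiableAt ℂ ((hs.localInverse _ _ _ hne) ∘ fun z => F z i) w := by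
    refine DifferentiableAt.comp w ?_ hFi
    rw [← h w hw]
    exact hinv
  refine hcomp.congr_of_eventuallyEq ?_
  filter_upwards [hcont.eventually hloc, hnhds] with z hz hzb
  rw [Function.comp_apply, ← h z hzb]
  exact hz.symm

end Embedding

/-! ### Homomorphisms between the algebras of embedded discs -/

section Algebras
variable {d : ℕ} {V : Set (UnitBall d)} {f : ℂ → CSpace d}

/-- The embedding map, as a map from the open disc to the open ball. -/
noncomputable def IsEmbeddingMap.toBall (hf : IsEmbeddingMap f V) (z : Disc) : UnitBall d :=
  (hf.equiv z : V)

theorem IsEmbeddingMap.coe_toBall (hf : IsEmbeddingMap f V) (z : Disc) :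
    (hf.toBall z : CSpace d) = f z := by
  have h := (Equiv.Set.image ((↑) : UnitBall d → CSpace d) V Subtype.val_injective).apply_symm_apply
    (BijOn.equiv f hf.bijOn z)
  exact congrArg Subtype.val h

theorem IsEmbeddingMap.mapsTo (hf : IsEmbeddingMap f V) : MapsTo f (ball 0 1) (ball 0 1) :=
  fun z hz => hf.coe_toBall ⟨z, hz⟩ ▸ (hf.toBall ⟨z, hz⟩).2

theorem IsEmbeddingMap.toBall_eq (hf : IsEmbeddingMap f V) (z : Disc) :
    hf.toBall z = ⟨f z, hf.mapsTo z.2⟩ := Subtype.ext (hf.coe_toBall z)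

theorem IsEmbeddingMap.mem_algebra_iff (hf : IsEmbeddingMap f V) {φ : Disc → ℂ} :
    φ ∈ hf.algebra ↔ ∃ ψ ∈ multiplierAlgebra d, ∀ z, φ z = ψ (hf.toBall z) := by
  constructor
  · rintro ⟨ψ, hψ, h⟩
    refine ⟨ψ, hψ, fun z => ?_⟩
    have := congrFun h (hf.equiv z)
    change ψ (hf.equiv z : V) = φ (hf.equiv.symm (hf.equiv z)) at this
    rw [Equiv.symm_apply_apply] at this
    exact this.symm
  · rintro ⟨ψ, hψ, h⟩
    refine ⟨ψ, hψ, funext fun v => ?_⟩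
    change ψ v = φ (hf.equiv.symm v)
    rw [h, IsEmbeddingMap.toBall, Equiv.apply_symm_apply]

/-- Composition of multipliers with the embedding map. -/
noncomputable def IsEmbeddingMap.pullback (hf : IsEmbeddingMap f V) :
    multiplierAlgebra d →ₐ[ℂ] hf.algebra :=
  ((compHom hf.toBall).comp (multiplierAlgebra d).val).codRestrict hf.algebra
    fun ψ => hf.mem_algebra_iff.mpr ⟨ψ.1, ψ.2, fun _ => rfl⟩

theorem IsEmbeddingMap.pullback_apply (hf : IsEmbeddingMap f V) (ψ : multiplierAlgebra d)
    (z : Disc) : (hf.pullback ψ).1 z = ψ.1 (hf.toBall z) := rfl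

theorem IsEmbeddingMap.exists_eq_pullback (hf : IsEmbeddingMap f V) (φ : hf.algebra) :
    ∃ ψ, hf.pullback ψ = φ := by
  obtain ⟨ψ, hψ, h⟩ := hf.mem_algebra_iff.mp φ.2
  exact ⟨⟨ψ, hψ⟩, Subtype.ext (funext fun z => (h z).symm)⟩

variable {e : ℕ} {W : Set (UnitBall e)} {g : ℂ → CSpace e}

/-- An injective homomorphism between the algebras of embedded discs is the composition with an
analytic self-map of the disc. -/
theorem exists_symbol (hf : IsEmbeddingMap f V) (hg : IsEmbeddingMap g W)
    (Φ : hf.algebra →ₐ[ℂ] hg.algebra) (hΦ : Function.Injective Φ) :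
    ∃ (μ : ℂ → ℂ) (mμ : MapsTo μ (ball 0 1) (ball 0 1)), DifferentiableOn ℂ μ (ball 0 1) ∧
      ∀ (φ : hf.algebra) (w : Disc), (Φ φ).1 w = φ.1 ⟨μ w, mμ w.2⟩ := by
  let χ : Disc → multiplierAlgebra d →ₐ[ℂ] ℂ := fun w =>
    (Pi.evalAlgHom ℂ (fun _ : Disc => ℂ) w).comp (hg.algebra.val.comp (Φ.comp hf.pullback))
  have hχ : ∀ w ψ, χ w ψ = (Φ (hf.pullback ψ)).1 w := fun _ _ => rfl
  choose ψ hψ hψe using fun i : Fin d =>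
    hg.mem_algebra_iff.mp (Φ (hf.pullback (coordMultiplier i))).2
  let F : ℂ → CSpace d := fun z => WithLp.toLp 2 fun i => extendZero (ψ i) (g z)
  have hFχ : ∀ w : Disc, characterPoint (χ w) = F w := by
    intro w
    ext i
    change χ w (coordMultiplier i) = extendZero (ψ i) (g w)
    rw [hχ, hψe, extendZero_of_mem _ (hg.mapsTo w.2), hg.toBall_eq]
  have hF : DifferentiableOn ℂ F (ball 0 1) := differentiableOn_euclidean.mpr fun i =>
    differentiableOn_extendZero_comp (mem_druryArveson_of_mem_multiplierAlgebra (hψ i))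
      isOpen_ball hg.differentiableOn hg.mapsTo
  have hle : ∀ z ∈ ball (0 : ℂ) 1, ‖F z‖ ≤ 1 := fun z hz => by
    rw [← hFχ ⟨z, hz⟩]
    exact norm_characterPoint_le_one _
  -- By the maximum principle the fibres either all lie over the open ball or all over one point of
  -- the sphere; in the latter case the coordinates of `f` would be constant.
  have hlt : ∀ z ∈ ball (0 : ℂ) 1, ‖F z‖ < 1 := by
    by_contra! h
    obtain ⟨z₀, hz₀, h1⟩ := h
    have hmax : IsMaxOn (norm ∘ F) (ball 0 1) z₀ := fun z hz => (hle z hz).trans h1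
    have hconst := Complex.eqOn_of_isPreconnected_of_isMaxOn_norm
      (convex_ball (0 : ℂ) 1).isPreconnected isOpen_ball hF hz₀ hmax
    have hcoord : ∀ i, hf.pullback (coordMultiplier i) = algebraMap ℂ _ (F z₀ i) := by
      intro i
      refine hΦ (Subtype.ext (funext fun w => ?_))
      rw [AlgHom.commutes, ← hχ]
      have h2 : χ w (coordMultiplier i) = F w i := by
        rw [← hFχ]
        rfl
      rw [h2, hconst w.2]
      rfl
    have hfc : ∀ w : Disc, f w = F z₀ := by
      intro w
      ext i
      have h2 := congrFun (congrArg Subtype.val (hcoord i)) w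
      rw [hf.pullback_apply] at h2
      rw [← hf.coe_toBall]
      exact h2
    have h0 : (0 : ℂ) ∈ ball (0 : ℂ) 1 := by simp
    have hh : (1 / 2 : ℂ) ∈ ball (0 : ℂ) 1 := by
      rw [mem_ball_zero_iff]
      norm_num
    have := hf.bijOn.injOn h0 hh ((hfc ⟨0, h0⟩).trans (hfc ⟨1 / 2, hh⟩).symm)
    norm_num at this
  let p : Disc → UnitBall d := fun w => ⟨F w, mem_ball_zero_iff.mpr (hlt w w.2)⟩
  have heval : ∀ w ψ, χ w ψ = ψ.1 (p w) := fun w ψ => character_apply_eq (hFχ w) ψ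
  have hV : ∀ w, p w ∈ V := by
    intro w
    obtain ⟨S, hS, hVS⟩ := hf.isVariety
    rw [hVS]
    intro φ hφ
    have hφV : ∀ x ∈ V, φ x = 0 := fun x hx => by
      rw [hVS] at hx
      exact hx φ hφ
    have h0 : hf.pullback ⟨φ, hS hφ⟩ = 0 := by
      ext z
      exact hφV _ (hf.equiv z).2
    have h1 := heval w ⟨φ, hS hφ⟩
    rw [hχ, h0, map_zero] at h1
    exact h1.symm
  have hex : ∀ w : Disc, ∃ z ∈ ball (0 : ℂ) 1, f z = F w := fun w =>
    hf.bijOn.surjOn ⟨p w, hV w, rfl⟩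
  choose m hm hfm using hex
  classical
  let μ : ℂ → ℂ := fun z => if h : z ∈ ball (0 : ℂ) 1 then m ⟨z, h⟩ else 0
  have hμ : ∀ w : Disc, μ w = m w := fun w => dif_pos w.2
  have mμ : MapsTo μ (ball 0 1) (ball 0 1) := fun z hz => by
    rw [hμ ⟨z, hz⟩]
    exact hm _
  refine ⟨μ, mμ, hf.differentiableOn_lift hF mμ fun z hz => ?_, fun φ w => ?_⟩
  · rw [hμ ⟨z, hz⟩]
    exact hfm _
  · obtain ⟨η, rfl⟩ := hf.exists_eq_pullback φ
    rw [← hχ, heval, hf.pullback_apply]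
    refine congrArg η.1 (Subtype.ext ?_)
    rw [hf.coe_toBall]
    exact (hfm w).symm.trans (congrArg f (hμ w).symm)

/-- An isomorphism between the algebras of embedded discs is the composition with a biholomorphic
self-map of the disc that extends continuously to the closed disc, as does its inverse. -/
theorem exists_symbol_of_equiv (hf : IsEmbeddingMap f V) (hg : IsEmbeddingMap g W)
    (Φ : hf.algebra ≃ₐ[ℂ] hg.algebra) :
    ∃ μ ν : ℂ → ℂ, IsDiscAutomorphism μ ∧ IsDiscAutomorphism ν ∧
      (∀ z ∈ closedBall (0 : ℂ) 1, ν (μ z) = z) ∧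
      (∀ ψ ∈ multiplierAlgebra d, ∃ η ∈ multiplierAlgebra e, ∀ w ∈ ball (0 : ℂ) 1,
        extendZero η (g w) = extendZero ψ (f (ν w))) ∧
      (∀ ψ ∈ multiplierAlgebra e, ∃ η ∈ multiplierAlgebra d, ∀ w ∈ ball (0 : ℂ) 1,
        extendZero η (f w) = extendZero ψ (g (μ w))) := by
  obtain ⟨ν₀, mν, dν, hν⟩ := exists_symbol hf hg Φ.toAlgHom Φ.injective
  obtain ⟨μ₀, mμ, dμ, hμ⟩ := exists_symbol hg hf Φ.symm.toAlgHom Φ.symm.injective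
  have hνμ : ∀ z ∈ ball (0 : ℂ) 1, ν₀ (μ₀ z) = z := by
    intro z hz
    refine hf.bijOn.injOn (mν (mμ hz)) hz ?_
    ext i
    have h1 := hμ (Φ (hf.pullback (coordMultiplier i))) ⟨z, hz⟩
    have h2 := hν (hf.pullback (coordMultiplier i)) ⟨μ₀ z, mμ hz⟩
    have h3 : Φ.symm (Φ (hf.pullback (coordMultiplier i))) = hf.pullback (coordMultiplier i) :=
      Φ.symm_apply_apply _
    change (Φ.symm (Φ (hf.pullback (coordMultiplier i)))).1 ⟨z, hz⟩ = _ at h1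
    rw [h3] at h1
    have h4 := h1.trans h2
    simp only [hf.pullback_apply, coordMultiplier, hf.toBall_eq] at h4
    exact h4.symm
  have hμν : ∀ z ∈ ball (0 : ℂ) 1, μ₀ (ν₀ z) = z := by
    intro z hz
    refine hg.bijOn.injOn (mμ (mν hz)) hz ?_
    ext i
    have h1 := hν (Φ.symm (hg.pullback (coordMultiplier i))) ⟨z, hz⟩
    have h2 := hμ (hg.pullback (coordMultiplier i)) ⟨ν₀ z, mν hz⟩
    have h3 : Φ (Φ.symm (hg.pullback (coordMultiplier i))) = hg.pullback (coordMultiplier i) :=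
      Φ.apply_symm_apply _
    change (Φ (Φ.symm (hg.pullback (coordMultiplier i)))).1 ⟨z, hz⟩ = _ at h1
    rw [h3] at h1
    have h4 := h1.trans h2
    simp only [hg.pullback_apply, coordMultiplier, hg.toBall_eq] at h4
    exact h4.symm
  obtain ⟨μ, cμ, eμ⟩ := exists_continuousOn_extension dμ dν mμ mν hνμ
  obtain ⟨ν, cν, eν⟩ := exists_continuousOn_extension dν dμ mν mμ hμν
  have mμ' : MapsTo μ (closedBall 0 1) (closedBall 0 1) := by
    have := (mμ.congr eμ.symm).closure_of_continuousOn (by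
      rwa [closure_ball (0 : ℂ) one_ne_zero])
    rwa [closure_ball (0 : ℂ) one_ne_zero] at this
  refine ⟨μ, ν, ⟨dμ.congr eμ, ?_, cμ⟩, ⟨dν.congr eν, ?_, cν⟩, ?_, ?_, ?_⟩
  · exact (InvOn.bijOn ⟨hνμ, hμν⟩ mμ mν).congr eμ.symm
  · exact (InvOn.bijOn ⟨hμν, hνμ⟩ mν mμ).congr eν.symm
  · have : EqOn (ν ∘ μ) id (ball 0 1) := fun z hz => by
      rw [Function.comp_apply, eμ hz, eν (mμ hz), hνμ z hz, id]
    exact this.of_subset_closure (cν.comp cμ mμ') continuousOn_id ball_subset_closedBall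
      (closure_ball (0 : ℂ) one_ne_zero).ge
  · intro ψ hψ
    obtain ⟨η, hη, h⟩ := hg.mem_algebra_iff.mp (Φ (hf.pullback ⟨ψ, hψ⟩)).2
    refine ⟨η, hη, fun w hw => ?_⟩
    have h1 := hν (hf.pullback ⟨ψ, hψ⟩) ⟨w, hw⟩
    rw [eν hw, extendZero_of_mem _ (hg.mapsTo hw), extendZero_of_mem _ (hf.mapsTo (mν hw)),
      ← hg.toBall_eq ⟨w, hw⟩, ← hf.toBall_eq ⟨ν₀ w, mν hw⟩, ← h]
    exact h1
  · intro ψ hψ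
    obtain ⟨η, hη, h⟩ := hf.mem_algebra_iff.mp (Φ.symm (hg.pullback ⟨ψ, hψ⟩)).2
    refine ⟨η, hη, fun w hw => ?_⟩
    have h1 := hμ (hg.pullback ⟨ψ, hψ⟩) ⟨w, hw⟩
    rw [eμ hw, extendZero_of_mem _ (hf.mapsTo hw), extendZero_of_mem _ (hg.mapsTo (mμ hw)),
      ← hf.toBall_eq ⟨w, hw⟩, ← hg.toBall_eq ⟨μ₀ w, mμ hw⟩, ← h]
    exact h1

end Algebras

/-! ### Boundary values -/

/-- A quantitative form of the Schwarz–Pick lemma. -/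
theorem one_sub_norm_sq_ge {h : ℂ → ℂ} (hd : DifferentiableOn ℂ h (ball 0 1))
    (hm : MapsTo h (ball 0 1) (ball 0 1)) {ρ : ℝ} (hρ : ‖h 0‖ ≤ ρ) (hρ1 : ρ < 1) {z : ℂ}
    (hz : ‖z‖ < 1) : (1 - ρ) / 2 * (1 - ‖z‖) ≤ 1 - ‖h z‖ ^ 2 := by
  have h0 : ‖-h 0‖ < 1 := by rw [norm_neg]; exact hρ.trans_lt hρ1
  have hz1 : ‖h z‖ < 1 := mem_ball_zero_iff.mp (hm (mem_ball_zero_iff.mpr hz))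
  have hs : ‖mobius (-h 0) (h z)‖ ≤ ‖z‖ := by
    refine Complex.norm_le_norm_of_mapsTo_ball (f := fun z => mobius (-h 0) (h z)) (R := 1)
      (((differentiableOn_mobius h0).mono ball_subset_closedBall).comp hd hm) (fun w hw => ?_)
      (by simp [mobius]) hz
    exact mem_closedBall_zero_iff.mpr (norm_mobius_lt_one h0 (mem_ball_zero_iff.mp (hm hw))).le
  have hne := mobius_denom_ne_zero h0 hz1.le
  rw [mobius, norm_div, div_le_iff₀ (norm_pos_iff.mpr hne)] at hs
  have e : ‖1 + conj (-h 0) * h z‖ ^ 2 - ‖h z + -h 0‖ ^ 2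
      = (1 - ‖h 0‖ ^ 2) * (1 - ‖h z‖ ^ 2) := by
    simp only [← Complex.normSq_eq_norm_sq, Complex.normSq_apply, Complex.add_re, Complex.add_im,
      Complex.mul_re, Complex.mul_im, Complex.conj_re, Complex.conj_im, Complex.one_re,
      Complex.one_im, Complex.neg_re, Complex.neg_im]
    ring
  have h1 : 1 - ‖h 0‖ ≤ ‖1 + conj (-h 0) * h z‖ := by
    have := norm_sub_le (1 + conj (-h 0) * h z) (conj (-h 0) * h z)
    rw [add_sub_cancel_right, norm_one, norm_mul, RCLike.norm_conj, norm_neg] at this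
    nlinarith [norm_nonneg (h 0), norm_nonneg (h z)]
  have h2 := pow_le_pow_left₀ (norm_nonneg _) hs 2
  rw [mul_pow] at h2
  have hr := norm_nonneg z
  have ha := norm_nonneg (h 0)
  have h3 : (1 - ‖z‖ ^ 2) * (1 - ‖h 0‖) ^ 2 ≤ (1 - ‖h 0‖ ^ 2) * (1 - ‖h z‖ ^ 2) := by
    have h4 : (1 - ‖h 0‖) ^ 2 ≤ ‖1 + conj (-h 0) * h z‖ ^ 2 :=
      pow_le_pow_left₀ (by linarith) h1 2
    have h5 : 0 ≤ 1 - ‖z‖ ^ 2 := by nlinarith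
    nlinarith [mul_le_mul_of_nonneg_left h4 h5]
  have h6 : (1 - ‖z‖ ^ 2) * (1 - ‖h 0‖) ≤ (1 + ‖h 0‖) * (1 - ‖h z‖ ^ 2) := by
    have : 0 < 1 - ‖h 0‖ := by linarith
    refine le_of_mul_le_mul_left ?_ this
    nlinarith
  have h7 : 0 ≤ 1 - ‖h z‖ ^ 2 := by nlinarith [norm_nonneg (h z)]
  nlinarith [mul_nonneg h7 (by linarith : 0 ≤ 1 - ‖h 0‖),
    mul_nonneg (by linarith : (0 : ℝ) ≤ 1 - ‖z‖) (by linarith : 0 ≤ ρ - ‖h 0‖),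
    mul_nonneg (mul_nonneg hr (by linarith : (0 : ℝ) ≤ 1 - ‖z‖)) (by linarith : 0 ≤ 1 - ‖h 0‖)]

section Boundary
variable {d : ℕ} {V : Set (UnitBall d)} {f : ℂ → CSpace d}

theorem IsEmbeddingMap.norm_le_one (hf : IsEmbeddingMap f V) {z : ℂ} (hz : z ∈ closedBall 0 1) :
    ‖f z‖ ≤ 1 := by
  rcases (mem_closedBall_zero_iff.mp hz).lt_or_eq with h | h
  · exact (mem_ball_zero_iff.mp (hf.mapsTo (mem_ball_zero_iff.mpr h))).le
  · exact ((hf.norm_eq_one_iff z hz).mpr h).le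

/-- The Hopf lemma for embedded discs: the distance of `f z` to the sphere is at least comparable
to the distance of `z` to the circle. -/
theorem IsEmbeddingMap.exists_one_sub_norm_sq_ge (hf : IsEmbeddingMap f V) :
    ∃ c : ℝ, 0 < c ∧ ∀ z : ℂ, ‖z‖ < 1 → c * (1 - ‖z‖) ≤ 1 - ‖f z‖ ^ 2 := by
  have h0 : ‖f 0‖ < 1 := mem_ball_zero_iff.mp (hf.mapsTo (by simp))
  refine ⟨(1 - ‖f 0‖) / 2, by linarith, fun z hz => ?_⟩
  have hzb : z ∈ ball (0 : ℂ) 1 := mem_ball_zero_iff.mpr hz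
  rcases eq_or_ne (f z) 0 with h | h
  · rw [h, norm_zero]
    nlinarith [norm_nonneg z, norm_nonneg (f 0)]
  -- Apply the scalar estimate to the component of `f` in the direction of `f z`.
  let q : CSpace d := ((‖f z‖⁻¹ : ℝ) : ℂ) • f z
  have hz0 : 0 < ‖f z‖ := norm_pos_iff.mpr h
  have hq : ‖q‖ = 1 := by
    rw [norm_smul, Complex.norm_real, norm_inv, norm_norm, inv_mul_cancel₀ hz0.ne']
  have hle : ∀ w, ‖(inner ℂ q (f w) : ℂ)‖ ≤ ‖f w‖ := fun w => by
    simpa [hq] using norm_inner_le_norm (𝕜 := ℂ) q (f w)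
  have hqz : ‖(inner ℂ q (f z) : ℂ)‖ = ‖f z‖ := by
    rw [inner_smul_left, inner_self_eq_norm_sq_to_K, norm_mul, RCLike.norm_conj, Complex.norm_real,
      norm_inv, norm_norm, norm_pow]
    simp only [Complex.coe_algebraMap, Complex.norm_real, norm_norm]
    field_simp
  rw [← hqz]
  refine one_sub_norm_sq_ge (h := fun w => inner ℂ q (f w)) ?_ ?_ (hle 0) h0 hz
  · exact (innerSL ℂ q).differentiable.comp_differentiableOn hf.differentiableOn
  · exact fun w hw => mem_ball_zero_iff.mpr
      ((hle w).trans_lt (mem_ball_zero_iff.mp (hf.mapsTo hw)))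

/-- The real derivative of an embedding map at a boundary point is still complex linear. -/
theorem IsEmbeddingMap.fderivWithin_I_mul (hf : IsEmbeddingMap f V) {ξ : ℂ}
    (hξ : ξ ∈ closedBall (0 : ℂ) 1) (w : ℂ) :
    fderivWithin ℝ f (closedBall 0 1) ξ (Complex.I * w)
      = Complex.I • fderivWithin ℝ f (closedBall 0 1) ξ w := by
  have hu : UniqueDiffOn ℝ (closedBall (0 : ℂ) 1) :=
    uniqueDiffOn_convex (convex_closedBall 0 1) (by
      rw [interior_closedBall (0 : ℂ) one_ne_zero]
      exact ⟨0, by simp⟩)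
  have hc := hf.contDiffOn.continuousOn_fderivWithin hu (by norm_num)
  have heq : EqOn (fun z => fderivWithin ℝ f (closedBall 0 1) z (Complex.I * w))
      (fun z => Complex.I • fderivWithin ℝ f (closedBall 0 1) z w) (ball 0 1) := by
    intro z hz
    have h1 : fderivWithin ℝ f (closedBall 0 1) z = fderiv ℝ f z :=
      fderivWithin_of_mem_nhds (mem_of_superset (isOpen_ball.mem_nhds hz) ball_subset_closedBall)
    have h2 := (hf.differentiableOn.differentiableAt (isOpen_ball.mem_nhds hz)).hasFDerivAt
    have h3 : fderiv ℝ f z = (fderiv ℂ f z).restrictScalars ℝ :=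
      (h2.restrictScalars ℝ).fderiv
    simp only [h1, h3, ContinuousLinearMap.coe_restrictScalars']
    rw [← smul_eq_mul, map_smul]
  have hcw : ∀ w : ℂ, ContinuousOn (fun z => fderivWithin ℝ f (closedBall 0 1) z w)
      (closedBall 0 1) := fun w => hc.clm_apply continuousOn_const
  have hcI : ContinuousOn (fun z => Complex.I • fderivWithin ℝ f (closedBall 0 1) z w)
      (closedBall 0 1) := (hcw w).const_smul Complex.I
  exact heq.of_subset_closure (hcw _) hcI ball_subset_closedBall
    (closure_ball (0 : ℂ) one_ne_zero).ge hξ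

/-- At a boundary point the embedding map meets the sphere transversally: up to first order, the
radial curve `f((1 - s) ξ)` leaves the sphere in a direction `-v` with `⟪f ξ, v⟫` real and
positive. -/
theorem IsEmbeddingMap.exists_radial_derivative (hf : IsEmbeddingMap f V) {ξ : ℂ}
    (hξ : ξ ∈ sphere (0 : ℂ) 1) :
    ∃ (v : CSpace d) (A : ℝ), 0 < A ∧ inner ℂ (f ξ) v = (A : ℂ) ∧
      Tendsto (fun s : ℝ => (s⁻¹ : ℝ) • (f ((1 - s : ℝ) • ξ) - f ξ)) (𝓝[>] 0) (𝓝 (-v)) := by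
  have hξ1 : ‖ξ‖ = 1 := mem_sphere_zero_iff_norm.mp hξ
  have hξc : ξ ∈ closedBall (0 : ℂ) 1 := sphere_subset_closedBall hξ
  have hp : ‖f ξ‖ = 1 := (hf.norm_eq_one_iff ξ hξc).mpr hξ1
  set D := fderivWithin ℝ f (closedBall 0 1) ξ with hD
  have hfd : HasFDerivWithinAt f D (closedBall 0 1) ξ :=
    (hf.contDiffOn.differentiableOn (by norm_num) ξ hξc).hasFDerivWithinAt
  let L : CSpace d →L[ℝ] ℝ := Complex.reCLM.comp ((innerSL ℂ (f ξ)).restrictScalars ℝ)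
  have hL : ∀ x, L x = (inner ℂ (f ξ) x : ℂ).re := fun _ => rfl
  have hLle : ∀ x, L x ≤ ‖x‖ := fun x => by
    refine (Complex.re_le_norm _).trans ?_
    simpa [hp] using norm_inner_le_norm (𝕜 := ℂ) (f ξ) x
  have hLp : L (f ξ) = 1 := by
    rw [hL, inner_self_eq_norm_sq_to_K, hp]
    simp
  -- The radial derivative.
  have hline : HasDerivWithinAt (fun s : ℝ => (1 - s : ℝ) • ξ) (-ξ) (Icc 0 1) 0 := by
    have := (((hasDerivAt_id (0 : ℝ)).const_sub 1).smul_const ξ).hasDerivWithinAt (s := Icc 0 1)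
    simpa using this
  have hmaps : MapsTo (fun s : ℝ => (1 - s : ℝ) • ξ) (Icc 0 1) (closedBall 0 1) := by
    intro s hs
    rw [mem_closedBall_zero_iff, norm_smul, hξ1, mul_one, Real.norm_eq_abs, abs_le]
    constructor <;> linarith [hs.1, hs.2]
  have hfd' : HasFDerivWithinAt f D (closedBall 0 1) ((fun s : ℝ => (1 - s : ℝ) • ξ) 0) := by
    simpa using hfd
  have hrad : HasDerivWithinAt (fun s : ℝ => f ((1 - s : ℝ) • ξ)) (-(D ξ)) (Icc 0 1) 0 := by
    have := hfd'.comp_hasDerivWithinAt (0 : ℝ) hline hmaps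
    rwa [map_neg] at this
  have hslope : Tendsto (fun s : ℝ => (s⁻¹ : ℝ) • (f ((1 - s : ℝ) • ξ) - f ξ)) (𝓝[>] 0)
      (𝓝 (-(D ξ))) := by
    have h1 : HasDerivWithinAt (fun s : ℝ => f ((1 - s : ℝ) • ξ)) (-(D ξ)) (Ioi 0) 0 :=
      hrad.mono_of_mem_nhdsWithin (Icc_mem_nhdsGT zero_lt_one)
    have h2 := (hasDerivWithinAt_iff_tendsto_slope' (by simp)).mp h1
    refine h2.congr fun s => ?_
    simp [slope_def_module]
  -- The tangential derivative is orthogonal to the radius, because `Re ⟪f ξ, f⟫` is maximal at `ξ`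
  -- on the circle; complex linearity turns this into the reality of `⟪f ξ, D ξ⟫`.
  have him : (inner ℂ (f ξ) (D ξ) : ℂ).im = 0 := by
    let τ : ℝ → ℂ := fun θ => Complex.exp (θ * Complex.I) * ξ
    have hτ0 : τ 0 = ξ := by simp [τ]
    have hτ : HasDerivAt τ (Complex.I * ξ) 0 := by
      have h1 : HasDerivAt (fun θ : ℝ => (θ : ℂ) * Complex.I) Complex.I 0 := by
        simpa using ((hasDerivAt_id (0 : ℝ)).ofReal_comp).mul_const Complex.I
      simpa using h1.cexp.mul_const ξ
    have hτm : ∀ θ, τ θ ∈ closedBall (0 : ℂ) 1 := fun θ => by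
      rw [mem_closedBall_zero_iff, norm_mul, Complex.norm_exp_ofReal_mul_I, hξ1, one_mul]
    have h1 : HasDerivAt (fun θ => L (f (τ θ))) (L (D (Complex.I * ξ))) 0 := by
      have h2 : HasFDerivWithinAt f D (closedBall 0 1) (τ 0) := by rwa [hτ0]
      have h3 := h2.comp_hasDerivWithinAt (0 : ℝ) (hτ.hasDerivWithinAt (s := univ))
        (fun θ _ => hτm θ)
      exact L.hasFDerivAt.comp_hasDerivAt (0 : ℝ) (hasDerivWithinAt_univ.mp h3)
    have hmax : IsLocalMax (fun θ => L (f (τ θ))) 0 := by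
      refine Eventually.of_forall fun θ => ?_
      simp only [hτ0, hLp]
      exact (hLle _).trans (hf.norm_le_one (hτm θ))
    have h4 := hmax.hasDerivAt_eq_zero h1
    rw [hf.fderivWithin_I_mul hξc, hL, inner_smul_right] at h4
    simpa using h4
  refine ⟨D ξ, (inner ℂ (f ξ) (D ξ) : ℂ).re, ?_, Complex.ext rfl him, hslope⟩
  obtain ⟨c, hc, hcf⟩ := hf.exists_one_sub_norm_sq_ge
  -- `1 - ‖f‖ ≤ 1 - Re ⟪f ξ, f⟫`, so the Hopf lemma bounds the derivative below.
  have hlim := (L.continuous.tendsto _).comp hslope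
  have : c / 2 ≤ -(L (-(D ξ))) := by
    refine ge_of_tendsto hlim.neg ?_
    filter_upwards [Ioo_mem_nhdsGT (zero_lt_one' ℝ)] with s hs
    have hns : ‖(1 - s : ℝ) • ξ‖ = 1 - s := by
      rw [norm_smul, hξ1, mul_one, Real.norm_eq_abs, abs_of_pos (by linarith [hs.2])]
    have h1 := hcf ((1 - s : ℝ) • ξ) (by rw [hns]; linarith [hs.1])
    rw [hns] at h1
    have h2 := hLle (f ((1 - s : ℝ) • ξ))
    have h3 : ‖f ((1 - s : ℝ) • ξ)‖ ≤ 1 := hf.norm_le_one (hmaps ⟨hs.1.le, hs.2.le⟩)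
    rw [Function.comp_apply, map_smul, map_sub, hLp, smul_eq_mul, ← mul_neg, neg_sub,
      le_inv_mul_iff₀ hs.1]
    nlinarith [norm_nonneg (f ((1 - s : ℝ) • ξ))]
  rw [map_neg, neg_neg] at this
  exact lt_of_lt_of_le (by positivity) this

end Boundary

section BoundaryValues
variable {d : ℕ} {V : Set (UnitBall d)} {f : ℂ → CSpace d}

/-- A Schwarz estimate in the ball: if the complex line through `a` and `b` stays in the ball up to
`R` times the distance of `b` from `a`, then a bounded analytic function takes close values at `a`
and `b`. -/
theorem norm_extendZero_sub_le {ψ : UnitBall d → ℂ} (hψ : ψ ∈ multiplierAlgebra d) {M : ℝ}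
    (hM : ∀ z, ‖ψ z‖ ≤ M) {a δ : CSpace d} {R : ℝ} (hR : 1 < R)
    (h : ∀ l : ℂ, ‖l‖ < R → a + l • δ ∈ ball (0 : CSpace d) 1) :
    ‖extendZero ψ (a + δ) - extendZero ψ a‖ ≤ 2 * M / R := by
  have hmaps : MapsTo (fun l : ℂ => a + l • δ) (ball 0 R) (ball 0 1) := fun l hl =>
    h l (mem_ball_zero_iff.mp hl)
  have hd : DifferentiableOn ℂ (fun l : ℂ => extendZero ψ (a + l • δ)) (ball 0 R) :=
    differentiableOn_extendZero_comp (mem_druryArveson_of_mem_multiplierAlgebra hψ) isOpen_ball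
      (by fun_prop) hmaps
  have hb : ∀ l ∈ ball (0 : ℂ) R, ‖extendZero ψ (a + l • δ)‖ ≤ M := fun l hl => by
    rw [extendZero_of_mem _ (hmaps hl)]
    exact hM _
  have h0 : (0 : ℂ) ∈ ball (0 : ℂ) R := mem_ball_self (by linarith)
  have h1 : (1 : ℂ) ∈ ball (0 : ℂ) R := by simpa using hR
  have := Complex.dist_le_div_mul_dist_of_mapsTo_ball (R₂ := 2 * M) hd (fun l hl => by
    rw [mem_closedBall, dist_eq_norm]
    refine (norm_sub_le _ _).trans ?_
    linarith [hb l hl, hb 0 h0]) h1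
  simpa [dist_eq_norm] using this

/-- A function `ψ ∘ f` that is continuous up to the circle has the boundary value at `ξ` given by
the radial limit of `ψ` at `f ξ`. The curve `f((1 - s) ξ)` and the radius to `f ξ` agree to first
order up to a complex tangential vector, hence are asymptotically at hyperbolic distance zero. -/
theorem IsEmbeddingMap.tendsto_radial (hf : IsEmbeddingMap f V) {ψ : UnitBall d → ℂ}
    (hψ : ψ ∈ multiplierAlgebra d) {b : ℂ → ℂ} (hb : ContinuousOn b (closedBall 0 1))
    (h : ∀ z ∈ ball (0 : ℂ) 1, extendZero ψ (f z) = b z) {ξ : ℂ} (hξ : ξ ∈ sphere (0 : ℂ) 1) :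
    Tendsto (fun t : ℝ => extendZero ψ (((1 - t : ℝ) : ℂ) • f ξ)) (𝓝[>] 0) (𝓝 (b ξ)) := by
  have hξ1 : ‖ξ‖ = 1 := mem_sphere_zero_iff_norm.mp hξ
  have hξc : ξ ∈ closedBall (0 : ℂ) 1 := sphere_subset_closedBall hξ
  have hp : ‖f ξ‖ = 1 := (hf.norm_eq_one_iff ξ hξc).mpr hξ1
  obtain ⟨v, A, hA, hpv, hslope⟩ := hf.exists_radial_derivative hξ
  obtain ⟨c, hc, hcf⟩ := hf.exists_one_sub_norm_sq_ge
  obtain ⟨M, hM⟩ := exists_norm_le_of_mem_multiplierAlgebra hψ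
  have hM0 : 0 ≤ M := (norm_nonneg _).trans (hM ⟨0, by simp⟩)
  let a : ℝ → CSpace d := fun s => f ((1 - s : ℝ) • ξ)
  let δ : ℝ → CSpace d := fun s => ((1 - s * A : ℝ) : ℂ) • f ξ - a s
  have hns : ∀ s ∈ Ioo (0 : ℝ) 1, ‖(1 - s : ℝ) • ξ‖ = 1 - s := fun s hs => by
    rw [norm_smul, hξ1, mul_one, Real.norm_eq_abs, abs_of_pos (by linarith [hs.2])]
  have hIoo : Ioo (0 : ℝ) 1 ∈ 𝓝[>] (0 : ℝ) := Ioo_mem_nhdsGT zero_lt_one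
  have hid : Tendsto (fun s : ℝ => s) (𝓝[>] 0) (𝓝 0) := tendsto_id.mono_left nhdsWithin_le_nhds
  have hline : Tendsto (fun s : ℝ => (1 - s : ℝ) • ξ) (𝓝[>] 0) (𝓝[closedBall 0 1] ξ) := by
    refine tendsto_nhdsWithin_iff.mpr ⟨?_, ?_⟩
    · have := (tendsto_const_nhds (x := (1 : ℝ))).sub hid |>.smul_const ξ
      simpa using this
    · filter_upwards [hIoo] with s hs
      rw [mem_closedBall_zero_iff, hns s hs]
      linarith [hs.1]
  have ha : Tendsto a (𝓝[>] 0) (𝓝 (f ξ)) :=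
    (hf.contDiffOn.continuousOn ξ hξc).tendsto.comp hline
  have hδ : Tendsto (fun s : ℝ => (s⁻¹ : ℝ) • δ s) (𝓝[>] 0) (𝓝 (v - (A : ℂ) • f ξ)) := by
    have h1 := (hslope.neg).sub (tendsto_const_nhds (x := (A : ℂ) • f ξ))
    rw [neg_neg] at h1
    refine h1.congr' ?_
    filter_upwards [self_mem_nhdsWithin] with s hs
    have hs0 : s ≠ 0 := (mem_Ioi.mp hs).ne'
    have e : δ s = -(f ((1 - s : ℝ) • ξ) - f ξ) - (s : ℝ) • (A : ℂ) • f ξ := by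
      simp only [δ, a]
      rw [← Complex.coe_smul s, smul_smul]
      push_cast
      module
    rw [e, smul_sub (s⁻¹) (-_), smul_smul, inv_mul_cancel₀ hs0, one_smul, smul_neg]
  have hdiff : Tendsto (fun s : ℝ => extendZero ψ (((1 - s * A : ℝ) : ℂ) • f ξ)
      - extendZero ψ (a s)) (𝓝[>] 0) (𝓝 0) := by
    refine Metric.tendsto_nhds.mpr fun ε hε => ?_
    let R : ℝ := 2 * M / ε + 2
    have hR : 1 < R := by
      have : 0 ≤ 2 * M / ε := by positivity
      simp only [R]
      linarith
    -- Along `a s + l • δ s` with `‖l‖ < R`, the norm squared exceeds `‖a s‖²` by `o(s)` only.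
    have hsmall : Tendsto (fun s : ℝ => 2 * R * ‖(inner ℂ (a s) ((s⁻¹ : ℝ) • δ s) : ℂ)‖
        + R ^ 2 * (s * ‖(s⁻¹ : ℝ) • δ s‖ ^ 2)) (𝓝[>] 0) (𝓝 0) := by
      have h1 := (ha.inner hδ (𝕜 := ℂ)).norm.const_mul (2 * R)
      have h2 := (hid.mul (hδ.norm.pow 2)).const_mul (R ^ 2)
      have h3 := h1.add h2
      rw [inner_sub_right, inner_smul_right, hpv, inner_self_eq_norm_sq_to_K, hp] at h3
      convert h3 using 2
      simp
    filter_upwards [hIoo, hsmall.eventually_lt_const hc] with s hs hlt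
    rw [dist_zero_right]
    have hs0 : s ≠ 0 := hs.1.ne'
    have hball : ∀ l : ℂ, ‖l‖ < R → a s + l • δ s ∈ ball (0 : CSpace d) 1 := by
      intro l hl
      have h1 := hcf _ (by rw [hns s hs]; linarith [hs.1])
      rw [hns s hs] at h1
      have h2 : ‖a s + l • δ s‖ ^ 2 ≤ ‖a s‖ ^ 2 + 2 * R * ‖(inner ℂ (a s) (δ s) : ℂ)‖
          + R ^ 2 * ‖δ s‖ ^ 2 := by
        rw [norm_add_sq (𝕜 := ℂ), norm_smul, mul_pow, inner_smul_right]
        have h3 : RCLike.re (l * inner ℂ (a s) (δ s)) ≤ R * ‖(inner ℂ (a s) (δ s) : ℂ)‖ := by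
          refine (RCLike.re_le_norm _).trans ?_
          rw [norm_mul]
          gcongr
        have h4 : ‖l‖ ^ 2 * ‖δ s‖ ^ 2 ≤ R ^ 2 * ‖δ s‖ ^ 2 := by gcongr
        linarith
      have h5 : 2 * R * ‖(inner ℂ (a s) (δ s) : ℂ)‖ + R ^ 2 * ‖δ s‖ ^ 2 < c * s := by
        have e1 : ‖(inner ℂ (a s) ((s⁻¹ : ℝ) • δ s) : ℂ)‖
            = s⁻¹ * ‖(inner ℂ (a s) (δ s) : ℂ)‖ := by
          rw [← Complex.coe_smul, inner_smul_right, norm_mul, Complex.norm_real, Real.norm_eq_abs,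
            abs_of_pos (inv_pos.mpr hs.1)]
        have e2 : ‖(s⁻¹ : ℝ) • δ s‖ = s⁻¹ * ‖δ s‖ := by
          rw [norm_smul, Real.norm_eq_abs, abs_of_pos (inv_pos.mpr hs.1)]
        rw [e1, e2] at hlt
        have h6 := mul_lt_mul_of_pos_right hlt hs.1
        refine lt_of_eq_of_lt ?_ h6
        field_simp
      rw [mem_ball_zero_iff]
      refine (sq_lt_one_iff₀ (norm_nonneg _)).mp ?_
      have : ‖a s‖ ^ 2 ≤ 1 - c * s := by
        simp only [a]
        linarith
      linarith
    have h7 := norm_extendZero_sub_le hψ hM hR hball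
    have e : a s + δ s = ((1 - s * A : ℝ) : ℂ) • f ξ := add_sub_cancel _ _
    rw [e] at h7
    refine h7.trans_lt ?_
    rw [div_lt_iff₀ (by linarith)]
    have : ε * R = 2 * M + 2 * ε := by
      simp only [R]
      field_simp
    linarith
  have hψa : Tendsto (fun s : ℝ => extendZero ψ (a s)) (𝓝[>] 0) (𝓝 (b ξ)) := by
    refine ((hb ξ hξc).tendsto.comp hline).congr' ?_
    filter_upwards [hIoo] with s hs
    refine (h _ ?_).symm
    rw [mem_ball_zero_iff, hns s hs]
    linarith [hs.1]
  have hsum := hdiff.add hψa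
  simp only [sub_add_cancel, zero_add] at hsum
  -- Reparametrize the radius by `t = s A`.
  have hscale : Tendsto (fun t : ℝ => t / A) (𝓝[>] 0) (𝓝[>] 0) := by
    refine tendsto_nhdsWithin_iff.mpr ⟨?_, ?_⟩
    · simpa using hid.div_const A
    · filter_upwards [self_mem_nhdsWithin] with t ht using div_pos ht hA
  refine (hsum.comp hscale).congr fun t => ?_
  simp only [Function.comp_apply, div_mul_cancel₀ t hA.ne']

/-- Functions in the algebra of an embedded disc that are continuous up to the circle respect its
self-crossings. -/
theorem IsEmbeddingMap.boundary_eq (hf : IsEmbeddingMap f V) {ψ : UnitBall d → ℂ}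
    (hψ : ψ ∈ multiplierAlgebra d) {b : ℂ → ℂ} (hb : ContinuousOn b (closedBall 0 1))
    (h : ∀ z ∈ ball (0 : ℂ) 1, extendZero ψ (f z) = b z) {ξ ζ : ℂ} (hξ : ξ ∈ sphere (0 : ℂ) 1)
    (hζ : ζ ∈ sphere (0 : ℂ) 1) (hfξ : f ξ = f ζ) : b ξ = b ζ := by
  have h1 := hf.tendsto_radial hψ hb h hξ
  rw [hfξ] at h1
  exact tendsto_nhds_unique h1 (hf.tendsto_radial hψ hb h hζ)

end BoundaryValues

theorem IsDiscAutomorphism.mapsTo_closedBall {μ : ℂ → ℂ} (hμ : IsDiscAutomorphism μ) :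
    MapsTo μ (closedBall 0 1) (closedBall 0 1) := by
  have := hμ.bijOn.mapsTo.closure_of_continuousOn (by
    rw [closure_ball (0 : ℂ) one_ne_zero]
    exact hμ.continuousOn)
  rwa [closure_ball (0 : ℂ) one_ne_zero] at this

/-- If the algebra of `f` contains the coordinates of `g ∘ μ`, then `g ∘ μ` has all self-crossings
of `f`. -/
theorem IsEmbeddingMap.selfCrossing_imp {d e : ℕ} {V : Set (UnitBall d)} {W : Set (UnitBall e)}
    {f : ℂ → CSpace d} {g : ℂ → CSpace e} (hf : IsEmbeddingMap f V) (hg : IsEmbeddingMap g W)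
    {μ : ℂ → ℂ} (hμ : IsDiscAutomorphism μ)
    (h : ∀ ψ ∈ multiplierAlgebra e, ∃ η ∈ multiplierAlgebra d, ∀ w ∈ ball (0 : ℂ) 1,
      extendZero η (f w) = extendZero ψ (g (μ w)))
    {ξ ζ : ℂ} (hξ : ξ ∈ sphere (0 : ℂ) 1) (hζ : ζ ∈ sphere (0 : ℂ) 1) (hfξ : f ξ = f ζ) :
    g (μ ξ) = g (μ ζ) := by
  ext i
  obtain ⟨η, hη, hηe⟩ := h _ (coord_mem_multiplierAlgebra i)
  have hcont : ContinuousOn (fun z => g (μ z) i) (closedBall 0 1) :=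
    (EuclideanSpace.proj i : CSpace e →L[ℂ] ℂ).continuous.comp_continuousOn
      (hg.contDiffOn.continuousOn.comp hμ.continuousOn hμ.mapsTo_closedBall)
  refine hf.boundary_eq hη hcont (fun z hz => ?_) hξ hζ hfξ
  rw [hηe z hz, extendZero_of_mem _ (hg.mapsTo (hμ.bijOn.mapsTo hz))]

end MultDisc

theorem mainTheorem3 {d e : ℕ}
    {V : Set (MultDisc.UnitBall d)} {W : Set (MultDisc.UnitBall e)}
    {f : ℂ → MultDisc.CSpace d} {g : ℂ → MultDisc.CSpace e}
    (hf : MultDisc.IsEmbeddingMap f V) (hg : MultDisc.IsEmbeddingMap g W)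
    (hiso : Nonempty (hf.algebra ≃ₐ[ℂ] hg.algebra)) :
    MultDisc.SameSelfCrossingType f g := by
  obtain ⟨Φ⟩ := hiso
  obtain ⟨μ, ν, hμ, hν, hνμ, hfg, hgf⟩ := MultDisc.exists_symbol_of_equiv hf hg Φ
  have hsphere : ∀ ξ ∈ sphere (0 : ℂ) 1, μ ξ ∈ sphere (0 : ℂ) 1 := by
    intro ξ hξ
    have hξc := sphere_subset_closedBall hξ
    have h1 := mem_closedBall_zero_iff.mp (hμ.mapsTo_closedBall hξc)
    refine mem_sphere_zero_iff_norm.mpr (h1.antisymm (not_lt.mp fun h2 => ?_))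
    have h3 := hν.bijOn.mapsTo (mem_ball_zero_iff.mpr h2)
    rw [hνμ ξ hξc] at h3
    exact (mem_ball_zero_iff.mp h3).ne (mem_sphere_zero_iff_norm.mp hξ)
  refine ⟨μ, hμ, fun ξ hξ ζ hζ => ⟨fun h => hf.selfCrossing_imp hg hμ hgf hξ hζ h, fun h => ?_⟩⟩
  have := hg.selfCrossing_imp hf hν hfg (hsphere ξ hξ) (hsphere ζ hζ) h
  rwa [hνμ ξ (sphere_subset_closedBall hξ), hνμ ζ (sphere_subset_closedBall hζ)] at this
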